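/- **Notation.** Let $D\in\mathbb N_0$ and equip $\mathbb R^D$ with the max-norm. $\chi_{\mathbf x}$ is (multiplication by) the indicator function of the open ball of radius $1/2$ around $\mathbf x$; $\operatorname{dist}$ is the distance in the max-norm, with $\operatorname{dist}(\cdot,\emptyset)=\infty$; $L^2(\Omega)$ is regarded as a subspace of $L^2(\mathbb R^D)$. $P_J(A)$ is the spectral projection of a self-adjoint operator $A$ and $P_E(A)=P_{\{E\}}(A)$. For $\Omega'\subseteq\Omega$ put $\Gamma_{\Omega,\Omega'}=\{\mathbf x\in\Omega' : \operatorname{dist}(\mathbf x,\Omega\cap\partial\Omega')\le 2\}$. Intervals may be of any type, and $|J|$ is the length of $J$. **Setting.** * (H), (O) $(\mathbf\Omega,\mathcal F,\mathbb P)$ is a probability space, $\mathfrak O$ is a family of open subsets of $\mathbb R^D$, and for every $\Omega\in\mathfrak O$, $(H_\Omega(\omega))_{\omega\in\mathbf\Omega}$ is a measurable family of self-adjoint operators in $L^2(\Omega)$ (i.e. $\omega\mapsto\langle f,(H_\Omega(\omega)-z)^{-1}g\rangle$ is measurable for all $f,g$ and $z\in\mathbb C\setminus\mathbb R$) such that for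 every $\omega$ the spectrum of $H_\Omega(\omega)$ is only pure point (the eigenvectors span a dense subspace). * (M) $\mathrm d$ is a pseudo-metric on $\mathbb R^D$ with $\sup_{\mathbf x\in\mathbb Z^D}\sum_{\mathbf y\in\mathbb Z^D}e^{-\mu\, \mathrm d(\mathbf x,\mathbf y)^\gamma}<\infty$ for all $\mu>0$, $\gamma\in(0,1]$. * (L) For every bounded interval $I\subset\mathbb R$ there is $C_I<\infty$ such that for all $\Omega,\Omega'\in\mathfrak O$ with $\Omega'\subseteq\Omega$ there is $\xi\in C^\infty(\mathbb R^D)$, $0\le\xi\le1$, with $\xi=1$ on $\Omega'\setminus\Gamma_{\Omega,\Omega'}$ and $\xi=0$ on $\Omega\setminus\Omega'$, such that for almost all $\omega$: (i) if $\phi\in\mathcal D(H_\Omega)$, then $\xi\phi\in\mathcal D(H_\Omega)\cap\mathcal D(H_{\Omega'})$ and $H_{\Omega'}\xi\phi=H_\Omega\xi\phi$; (ii) $\mathbf 1_{\Omega\setminus\Gamma_{\Omega,\Omega'}}[H_\Omega,\xi]=0$ on $\mathcal D(H_\Omega)$; (iii) $\|[H_\Omega,\xi]P_E(H_\Omega)\|\le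 C_I$ for every bounded interval $I$ and every eigenvalue $E\in I$ of $H_\Omega$. * (GW) There are constants $r_0,K\in\mathbb R$, $k\in\mathbb N_0$ and, for every bounded interval $I$, a constant $C_I<\infty$ such that for all $\mathbf x,\mathbf y\in\mathbb R^D$ with $\mathrm d(\mathbf x,\mathbf y)\ge r_0$ and all $\Omega\in\mathfrak O$ there are a bounded set $\Omega'\in\mathfrak O$ with $\Omega'\subseteq\Omega$, a sub-$\sigma$-algebra $\mathcal F'\subseteq\mathcal F$ and a choice $(\mathbf u,\mathbf w)=(\mathbf x,\mathbf y)$ or $(\mathbf u,\mathbf w)=(\mathbf y,\mathbf x)$ such that: (i) $B_{1/2}(\mathbf u)\cap\Omega\subseteq\Omega'\setminus\Gamma_{\Omega,\Omega'}$; $\mathrm d(\mathbf u,\mathbf v)\ge\frac14\mathrm d(\mathbf x,\mathbf y)$ for all $\mathbf v\in\Gamma_{\Omega,\Omega'}$; and $\Gamma_{\Omega,\Omega'}$ can be covered by at most $K(1+\mathrm d(\mathbf x,\mathbf y))^k$ open max-norm balls of radius $1$; (ii) the family $H_{\Omega'}$ is measurable with respect to $\mathcal F'$; (iii) $\mathbb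 E[\operatorname{Tr}(\chi_{\mathbf w}P_J(H_\Omega))\mid\mathcal F']\le C_I|J|$ almost surely, for every bounded interval $I$ and every interval $J\subseteq I$. * (W) For every bounded interval $I$ there is $C_I<\infty$ with $\mathbb E[\operatorname{Tr}(\chi_{\mathbf x}P_J(H_\Omega))]\le C_I|J|$ for all $\mathbf x\in\mathbb R^D$, $\Omega\in\mathfrak O$ and intervals $J\subseteq I$. **Theorem.** Assume (H), (O), (M), (L), (GW) and (W), and let $I\subset\mathbb R$ be a bounded interval. If there are $A,\nu\in(0,\infty)$, $s\in(0,1)$ and $\gamma\in(0,1]$ such that $$\sup_{\Omega\in\mathfrak O}\ \sup_{\operatorname{Re}z\in I,\ 0<|\operatorname{Im}z|<1}\mathbb E\big[\|\chi_{\mathbf x}(H_\Omega-z)^{-1}\chi_{\mathbf y}\|^s\big]\le A e^{-\nu\,\mathrm d(\mathbf x,\mathbf y)^\gamma}\qquad\text{for all }\mathbf x,\mathbf y\in\mathbb R^D,$$ then there are $C,\mu\in(0,\infty)$ such that $$\sup_{\Omega\in\mathfrak O}\mathbb E\Big[\sum_{E\in\sigma(H_\Omega)\cap I}\|\chi_{\mathbf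 x}P_E(H_\Omega)\|\,\|\chi_{\mathbf y}P_E(H_\Omega)\|\Big]\le C e^{-\mu\,\mathrm d(\mathbf x,\mathbf y)^\gamma}\qquad\text{for all }\mathbf x,\mathbf y\in\mathbb R^D$$ (the random variable inside the expectation being measurable up to a $\mathbb P$-null set). -/

import Mathlib

open MeasureTheory
open scoped ENNReal NNReal InnerProductSpace

noncomputable section

namespace RandOp

/-! ### Operators on a complex Hilbert space -/

section Hilbert

variable {E : Type*} [NormedAddCommGroup E] [InnerProductSpace ℂ E]

/-- The bounded operator `R` is a two-sided inverse of `A - z`, i.e. `R = (A - z)⁻¹`. -/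
def IsResolventAt (A : E →ₗ.[ℂ] E) (z : ℂ) (R : E →L[ℂ] E) : Prop :=
  (∀ f : E, ∃ h : R f ∈ A.domain, A ⟨R f, h⟩ - z • R f = f) ∧
    ∀ φ : A.domain, R (A φ - z • (φ : E)) = φ

open Classical in
/-- The resolvent `(A - z)⁻¹`; by convention it is `0` if `z` lies in the spectrum. -/
def resolventOp (A : E →ₗ.[ℂ] E) (z : ℂ) : E →L[ℂ] E :=
  if h : ∃ R, IsResolventAt A z R then h.choose else 0

/-- The (real part of the) spectrum `σ(A)`: the real numbers `t` for which `A - t` has no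
bounded two-sided inverse. For self-adjoint `A` this is the whole spectrum. -/
def spec (A : E →ₗ.[ℂ] E) : Set ℝ := {t | ¬ ∃ R, IsResolventAt A (t : ℂ) R}

/-- The eigenspace `ker (A - t)`. -/
def eigenspace (A : E →ₗ.[ℂ] E) (t : ℝ) : Submodule ℂ E where
  carrier := {φ | ∃ h : φ ∈ A.domain, A ⟨φ, h⟩ = (t : ℂ) • φ}
  zero_mem' := ⟨A.domain.zero_mem, by
    rw [smul_zero]; exact A.map_zero⟩
  add_mem' := by
    rintro a b ⟨ha, ha'⟩ ⟨hb, hb'⟩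
    refine ⟨A.domain.add_mem ha hb, ?_⟩
    rw [smul_add, ← ha', ← hb', ← A.map_add]
    rfl
  smul_mem' := by
    rintro c a ⟨ha, ha'⟩
    refine ⟨A.domain.smul_mem c ha, ?_⟩
    rw [smul_comm, ← ha', ← A.map_smul]
    rfl

/-- `A` has only pure point spectrum: its eigenvectors span a dense subspace. -/
def IsPurePoint (A : E →ₗ.[ℂ] E) : Prop :=
  (⨆ t : ℝ, eigenspace A t).topologicalClosure = ⊤

/-- The spectral projection `P_J(A)` of a self-adjoint operator with only pure point spectrum: the
orthogonal projection onto the closed span of the eigenvectors with eigenvalue in `J`.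
In particular `spectralProj A {t}` is `P_t(A)`, the projection onto `ker (A - t)`. -/
def spectralProj [CompleteSpace E] (A : E →ₗ.[ℂ] E) (J : Set ℝ) : E →L[ℂ] E :=
  (⨆ t ∈ J, eigenspace A t).topologicalClosure.starProjection

/-- The trace `∑ ⟨e, T e⟩ ∈ [0, ∞]` of a positive operator `T`, over an orthonormal basis
(the value does not depend on the basis). -/
def posTrace [CompleteSpace E] (T : E →L[ℂ] E) : ℝ≥0∞ :=
  ∑' e : (exists_hilbertBasis ℂ E).choose, ENNReal.ofReal (RCLike.re ⟪(e : E), T e⟫_ℂ)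

/-- Measurability, with respect to the σ-algebra `m`, of a family of self-adjoint operators:
weak measurability of all resolvents at non-real points. -/
def IsMeasurableFamily {W : Type*} (m : MeasurableSpace W) (A : W → (E →ₗ.[ℂ] E)) : Prop :=
  ∀ z : ℂ, z.im ≠ 0 → ∀ f g : E, Measurable[m] fun ω => ⟪f, resolventOp (A ω) z g⟫_ℂ

end Hilbert

/-! ### The spaces `L²(Ω) ⊆ L²(ℝᴰ)` -/

/-- `ℝᴰ` with the max-norm. -/
abbrev Conf (D : ℕ) : Type := Fin D → ℝ

/-- `L²(ℝᴰ)`. -/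
abbrev L2 (D : ℕ) : Type := Lp ℂ 2 (volume : Measure (Conf D))

variable {D : ℕ}

/-- `L²(Ω)`, as the closed subspace of `L²(ℝᴰ)` of the functions that vanish almost everywhere
outside `Ω`. -/
abbrev L2on (Ω : Set (Conf D)) : Submodule ℂ (L2 D) :=
  (LpToLpRestrictCLM (Conf D) ℂ ℂ volume 2 Ωᶜ).ker

theorem mem_L2on {Ω : Set (Conf D)} (f : L2 D) :
    f ∈ L2on Ω ↔ ∀ᵐ x ∂((volume : Measure (Conf D)).restrict Ωᶜ), f x = 0 := by
  have h := LpToLpRestrictCLM_coeFn (p := 2) (μ := (volume : Measure (Conf D))) ℂ Ωᶜ f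
  rw [LinearMap.mem_ker]
  constructor
  · intro h0
    have h1 : LpToLpRestrictCLM (Conf D) ℂ ℂ volume 2 Ωᶜ f = 0 := h0
    rw [h1] at h
    filter_upwards [h, Lp.coeFn_zero ℂ 2 ((volume : Measure (Conf D)).restrict Ωᶜ)] with x hx h2
    rw [← hx, h2]
    rfl
  · intro h0
    change LpToLpRestrictCLM (Conf D) ℂ ℂ volume 2 Ωᶜ f = 0
    rw [Lp.eq_zero_iff_ae_eq_zero]
    filter_upwards [h, h0] with x hx h2
    rw [hx, h2]
    rfl

open Classical in
/-- Multiplication by an essentially bounded function `g` on `L²(ℝᴰ)`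
(by convention `0` if `g` is not measurable and essentially bounded). -/
def mulOp (g : Conf D → ℝ) : L2 D →L[ℂ] L2 D :=
  if h : MemLp (fun x => (g x : ℂ)) ∞ (volume : Measure (Conf D)) then
    (ContinuousLinearMap.mul ℂ ℂ).holderL volume ∞ 2 2 (h.toLp (fun x => (g x : ℂ)))
  else 0

theorem mulOp_coeFn {g : Conf D → ℝ} (h : MemLp (fun x => (g x : ℂ)) ∞ (volume : Measure (Conf D)))
    (f : L2 D) : mulOp g f =ᵐ[volume] fun x => (g x : ℂ) * f x := by
  rw [mulOp, dif_pos h, ContinuousLinearMap.holderL_apply_apply]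
  filter_upwards [(ContinuousLinearMap.mul ℂ ℂ).coeFn_holder (r := 2)
    (h.toLp (fun x => (g x : ℂ))) f, h.coeFn_toLp] with x hx h2
  rw [hx, h2]
  rfl

theorem mulOp_mem_L2on (Ω : Set (Conf D)) (g : Conf D → ℝ) (f : L2on Ω) :
    mulOp g (f : L2 D) ∈ L2on Ω := by
  by_cases h : MemLp (fun x => (g x : ℂ)) ∞ (volume : Measure (Conf D))
  · rw [mem_L2on]
    filter_upwards [ae_restrict_of_ae (mulOp_coeFn h (f : L2 D)), (mem_L2on _).1 f.2] with x hx h2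
    rw [hx, h2, mul_zero]
  · rw [mulOp, dif_neg h]
    exact (L2on Ω).zero_mem

/-- Multiplication by an essentially bounded function `g` on `L²(Ω)`. -/
def mulOn (Ω : Set (Conf D)) (g : Conf D → ℝ) : L2on Ω →L[ℂ] L2on Ω :=
  ((mulOp g).comp (L2on Ω).subtypeL).codRestrict (L2on Ω) (mulOp_mem_L2on Ω g)

/-- The operator `χ_x` on `L²(Ω)`: multiplication by the indicator function of the open
max-norm ball of radius `1/2` around `x`. -/
def chi (Ω : Set (Conf D)) (x : Conf D) : L2on Ω →L[ℂ] L2on Ω :=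
  mulOn Ω ((Metric.ball x (1 / 2)).indicator 1)

/-- `Γ_{Ω,Ω'} = {x ∈ Ω' | dist(x, Ω ∩ ∂Ω') ≤ 2}`, with `dist(x, ∅) = ∞`. -/
def Gam (Ω Ω' : Set (Conf D)) : Set (Conf D) :=
  {x | x ∈ Ω' ∧ Metric.infEDist x (Ω ∩ frontier Ω') ≤ 2}

/-- `Tr (χ_w P_J(A)) = Tr (χ_w P_J(A) χ_w)`, with values in `[0, ∞]`. -/
def localTrace {Ω : Set (Conf D)} (A : L2on Ω →ₗ.[ℂ] L2on Ω) (w : Conf D) (J : Set ℝ) : ℝ≥0∞ :=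
  posTrace (chi Ω w ∘L spectralProj A J ∘L chi Ω w)

/-- Bounded intervals of the real line (of any type, possibly degenerate). -/
def IsBoundedInterval (I : Set ℝ) : Prop := I.OrdConnected ∧ Bornology.IsBounded I

/-! ### The abstract setting -/

/-- The operator assumptions: `𝔒` is a family of open sets, and for every `Ω ∈ 𝔒` the operators
`H Ω ω` form a measurable family of self-adjoint operators in `L²(Ω)` with only pure point
spectrum. -/
structure IsOperatorFamily {W : Type*} [mW : MeasurableSpace W] (𝔒 : Set (Set (Conf D)))
    (H : ∀ Ω : Set (Conf D), W → (L2on Ω →ₗ.[ℂ] L2on Ω)) : Prop where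
  isOpen : ∀ Ω ∈ 𝔒, IsOpen Ω
  selfAdjoint : ∀ Ω ∈ 𝔒, ∀ ω, IsSelfAdjoint (H Ω ω)
  measurable : ∀ Ω ∈ 𝔒, IsMeasurableFamily mW (H Ω)
  purePoint : ∀ Ω ∈ 𝔒, ∀ ω, IsPurePoint (H Ω ω)

/-- (M): `md` is a pseudo-metric on `ℝᴰ` for which `e^{-μ md(x,y)^γ}` is summable over `y ∈ ℤᴰ`,
uniformly in `x ∈ ℤᴰ`, for all `μ > 0` and `γ ∈ (0,1]`. -/
structure IsSummablePseudoMetric (md : Conf D → Conf D → ℝ) : Prop where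
  self : ∀ x, md x x = 0
  symm : ∀ x y, md x y = md y x
  triangle : ∀ x y z, md x z ≤ md x y + md y z
  summable : ∀ μ : ℝ, 0 < μ → ∀ γ : ℝ, 0 < γ → γ ≤ 1 → ∃ B : ℝ≥0, ∀ x : Fin D → ℤ,
    ∑' y : Fin D → ℤ,
      ENNReal.ofReal (Real.exp (-μ * md (fun i => (x i : ℝ)) (fun i => (y i : ℝ)) ^ γ)) ≤ B

/-- The commutator `[A, g] φ = A (g φ) - g (A φ)` for `φ ∈ D(A)`, when multiplication by `g`
preserves `D(A)`. -/
def commutator {Ω : Set (Conf D)} (A : L2on Ω →ₗ.[ℂ] L2on Ω) (g : Conf D → ℝ)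
    (h : ∀ φ : A.domain, mulOn Ω g φ ∈ A.domain) (φ : A.domain) : L2on Ω :=
  A ⟨mulOn Ω g φ, h φ⟩ - mulOn Ω g (A φ)

/-- The requirements (i)-(iii) of (L) on a cutoff function `ξ`, for `A = H_Ω(ω)` and
`A' = H_{Ω'}(ω)`; elements of `L²(Ω)` and `L²(Ω')` are compared in `L²(ℝᴰ)`. -/
def IsLocalPair {Ω Ω' : Set (Conf D)} (A : L2on Ω →ₗ.[ℂ] L2on Ω) (A' : L2on Ω' →ₗ.[ℂ] L2on Ω')
    (ξ : Conf D → ℝ) (C : Set ℝ → ℝ≥0) : Prop :=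
  ∃ h : ∀ φ : A.domain, mulOn Ω ξ φ ∈ A.domain,
    (∀ φ : A.domain, ∃ ψ : A'.domain,
      ((ψ : L2on Ω') : L2 D) = (mulOn Ω ξ φ : L2on Ω) ∧
      ((A' ψ : L2on Ω') : L2 D) = (A ⟨mulOn Ω ξ φ, h φ⟩ : L2on Ω)) ∧
    (∀ φ : A.domain, ∀ᵐ x : Conf D, x ∈ Ω \ Gam Ω Ω' →
      (commutator A ξ h φ : L2 D) x = 0) ∧
    ∀ I : Set ℝ, IsBoundedInterval I → ∀ t ∈ I, ∀ φ : A.domain, A φ = (t : ℂ) • (φ : L2on Ω) →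
      ‖commutator A ξ h φ‖ ≤ C I * ‖(φ : L2on Ω)‖

/-- (L): locality of the operators. -/
def Locality {W : Type*} [MeasurableSpace W] (P : Measure W) (𝔒 : Set (Set (Conf D)))
    (H : ∀ Ω : Set (Conf D), W → (L2on Ω →ₗ.[ℂ] L2on Ω)) : Prop :=
  ∃ C : Set ℝ → ℝ≥0, ∀ Ω ∈ 𝔒, ∀ Ω' ∈ 𝔒, Ω' ⊆ Ω → ∃ ξ : Conf D → ℝ,
    ContDiff ℝ (⊤ : ℕ∞) ξ ∧ (∀ x, 0 ≤ ξ x ∧ ξ x ≤ 1) ∧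
    (∀ x ∈ Ω' \ Gam Ω Ω', ξ x = 1) ∧ (∀ x ∈ Ω \ Ω', ξ x = 0) ∧
    ∀ᵐ ω ∂P, IsLocalPair (H Ω ω) (H Ω' ω) ξ C

/-- (GW): the geometric, conditional Wegner condition. -/
def GeometricWegner {W : Type*} [mW : MeasurableSpace W] (P : Measure W)
    (md : Conf D → Conf D → ℝ) (𝔒 : Set (Set (Conf D)))
    (H : ∀ Ω : Set (Conf D), W → (L2on Ω →ₗ.[ℂ] L2on Ω)) : Prop :=
  ∃ (r₀ K : ℝ) (k : ℕ) (C : Set ℝ → ℝ≥0), ∀ x y : Conf D, r₀ ≤ md x y → ∀ Ω ∈ 𝔒,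
    ∃ Ω' ∈ 𝔒, Bornology.IsBounded Ω' ∧ Ω' ⊆ Ω ∧ ∃ m : MeasurableSpace W, m ≤ mW ∧
    ∃ u w : Conf D, ((u = x ∧ w = y) ∨ (u = y ∧ w = x)) ∧
      Metric.ball u (1 / 2) ∩ Ω ⊆ Ω' \ Gam Ω Ω' ∧
      (∀ v ∈ Gam Ω Ω', md x y / 4 ≤ md u v) ∧
      (∃ T : Finset (Conf D), (T.card : ℝ) ≤ K * (1 + md x y) ^ k ∧
        Gam Ω Ω' ⊆ ⋃ v ∈ T, Metric.ball v 1) ∧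
      IsMeasurableFamily m (H Ω') ∧
      ∀ I : Set ℝ, IsBoundedInterval I → ∀ J ⊆ I, J.OrdConnected →
        condLExp m P (fun ω => localTrace (H Ω ω) w J) ≤ᵐ[P] fun _ => C I * volume J

/-- (W): the (unconditional) Wegner estimate. -/
def Wegner {W : Type*} [MeasurableSpace W] (P : Measure W) (𝔒 : Set (Set (Conf D)))
    (H : ∀ Ω : Set (Conf D), W → (L2on Ω →ₗ.[ℂ] L2on Ω)) : Prop :=
  ∀ I : Set ℝ, IsBoundedInterval I → ∃ C : ℝ≥0, ∀ x : Conf D, ∀ Ω ∈ 𝔒,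
    ∀ J ⊆ I, J.OrdConnected → ∫⁻ ω, localTrace (H Ω ω) x J ∂P ≤ C * volume J

/-- The eigenfunction correlator `∑_{t ∈ σ(A) ∩ I} ‖χ_x P_t(A)‖ ‖χ_y P_t(A)‖`. -/
def correlator {Ω : Set (Conf D)} (A : L2on Ω →ₗ.[ℂ] L2on Ω) (I : Set ℝ) (x y : Conf D) : ℝ≥0∞ :=
  ∑' t : ↥(spec A ∩ I),
    ‖chi Ω x ∘L spectralProj A {(t : ℝ)}‖ₑ * ‖chi Ω y ∘L spectralProj A {(t : ℝ)}‖ₑ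

end RandOp

end

open RandOp

/-! Let `φ` be an eigenfunction of `H_Ω` with eigenvalue `t`, and let `ξ` be the cutoff belonging to
`Ω' ⊆ Ω`. Then `(H_Ω' - t) ξφ = [H_Ω, ξ] φ` lives on `Γ`, far from `u`, so for every nonreal `z` one
has `χ_u φ = χ_u (H_Ω' - z)⁻¹ ([H_Ω, ξ] φ + (t - z) ξφ)`. This bounds `‖χ_u P_t‖` by resolvent norms
of `H_Ω'` between `u` and `Γ`, plus an error proportional to `|t - z|` (`amp_le_of_isLocalPair`).

Cut `I` into short cells with one deterministic `z` per cell. The resolvents are then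
`m`-measurable, while the conditional Wegner estimate controls the trace at the other point `w` in
each cell by the length of the cell. Since `‖χ_u P_t‖ ≤ 1`, its square is at most its `s`-th power,
so only fractional moments enter. Summation over the cells gives a factor `|I|`, and refinement of
the cells removes the error (`lintegral_tsum_amp_sq_le`, `exists_decay_amp_sq`). The outcome is
decay of the expected sum of `‖χ_x P_t‖² ‖χ_y P_t‖²`.

To pass to first powers, insert `1 ≤ ∑_z ‖χ_z P_t‖²` over the lattice (`amp_mul_amp_le_tsum`), group
the summand as `(‖χ_x P_t‖ ‖χ_z P_t‖) (‖χ_z P_t‖ ‖χ_y P_t‖)`, apply a weighted arithmetic-geometric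
inequality (`mul_le_weighted_sq`), and sum over `z` with (M).

Measurability is a separate thread: spectral projections are limits of polynomials in resolvents,
and sums over the random eigenvalues are limits of sums over deterministic cells
(`tendsto_tsum_cell`). -/

namespace RandOp

/-! ### Spectral calculus of self-adjoint operators with pure point spectrum. -/

section Spectral

open Filter Topology

variable {E : Type*} [NormedAddCommGroup E] [InnerProductSpace ℂ E] {A : E →ₗ.[ℂ] E}

theorem enorm_sq_eq_ofReal {F : Type*} [NormedAddCommGroup F] (f : F) : ‖f‖ₑ ^ 2 = ENNReal.ofReal (‖f‖ ^ 2) := by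
  rw [ENNReal.ofReal_pow (norm_nonneg _), ofReal_norm]

theorem mem_spec_of_eigenvector {t : ℝ} {φ : E} (hφ : φ ∈ eigenspace A t) (h0 : φ ≠ 0) :
    t ∈ spec A := by
  rintro ⟨R, hR⟩
  obtain ⟨h1, h2⟩ := hφ
  have h := hR.2 ⟨φ, h1⟩
  rw [h2] at h
  simp only [sub_self, map_zero] at h
  exact h0 h.symm

/-! ### Hilbert–Schmidt bounds -/

/-- The operator norm is bounded by the Hilbert–Schmidt norm. -/
theorem enorm_sq_le_tsum {ι : Type*} (b : HilbertBasis ι ℂ E) {F : Type*} [NormedAddCommGroup F]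
    [InnerProductSpace ℂ F] (T : E →L[ℂ] F) : ‖T‖ₑ ^ 2 ≤ ∑' i, ‖T (b i)‖ₑ ^ 2 := by
  by_cases hfin : ∑' i, ‖T (b i)‖ₑ ^ 2 = ∞
  · rw [hfin]; exact le_top
  have hsum : Summable fun i => ‖T (b i)‖ ^ 2 := by
    have := ENNReal.summable_toReal hfin
    refine this.congr fun i => ?_
    simp
  have heq : ∑' i, ‖T (b i)‖ₑ ^ 2 = ENNReal.ofReal (∑' i, ‖T (b i)‖ ^ 2) := by
    rw [ENNReal.ofReal_tsum_of_nonneg (fun _ => by positivity) hsum]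
    refine tsum_congr fun i => ?_
    rw [ENNReal.ofReal_pow (norm_nonneg _), ofReal_norm]
  rw [heq, ← ofReal_norm, ← ENNReal.ofReal_pow (norm_nonneg _)]
  refine ENNReal.ofReal_le_ofReal ?_
  set S := ∑' i, ‖T (b i)‖ ^ 2 with hS
  have hS0 : 0 ≤ S := tsum_nonneg fun _ => by positivity
  suffices h : ‖T‖ ≤ √S by
    calc ‖T‖ ^ 2 ≤ (√S) ^ 2 := by gcongr
      _ = S := Real.sq_sqrt hS0
  refine ContinuousLinearMap.opNorm_le_bound _ (Real.sqrt_nonneg _) fun f => ?_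
  have h1 : HasSum (fun i => b.repr f i • T (b i)) (T f) := by
    have := (b.hasSum_repr f).mapL T
    simpa using this
  refine le_of_tendsto h1.norm (Eventually.of_forall fun s => ?_)
  calc ‖∑ i ∈ s, b.repr f i • T (b i)‖ ≤ ∑ i ∈ s, ‖b.repr f i‖ * ‖T (b i)‖ :=
        (norm_sum_le _ _).trans (Finset.sum_le_sum fun i _ => (norm_smul _ _).le)
    _ ≤ √(∑ i ∈ s, ‖b.repr f i‖ ^ 2) * √(∑ i ∈ s, ‖T (b i)‖ ^ 2) :=
        Real.sum_mul_le_sqrt_mul_sqrt _ _ _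
    _ ≤ ‖f‖ * √S := by
        gcongr
        · rw [Real.sqrt_le_left (norm_nonneg _)]
          have := b.orthonormal.sum_inner_products_le (x := f) (s := s)
          simpa [b.repr_apply_apply] using this
        · exact hsum.sum_le_tsum s fun _ _ => by positivity
    _ = √S * ‖f‖ := mul_comm _ _

/-! ### Spectral projections -/

variable [CompleteSpace E]

theorem inner_symm_of_isSelfAdjoint (hA : IsSelfAdjoint A) (x y : A.domain) :
    ⟪A x, (y : E)⟫_ℂ = ⟪(x : E), A y⟫_ℂ := by
  have h := LinearPMap.adjoint_isFormalAdjoint hA.dense_domain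
  rw [LinearPMap.isSelfAdjoint_def.mp hA] at h
  exact h x y

theorem inner_eigenspace_eq_zero (hA : IsSelfAdjoint A) {s t : ℝ} (hst : s ≠ t) {φ ψ : E}
    (hφ : φ ∈ eigenspace A s) (hψ : ψ ∈ eigenspace A t) : ⟪φ, ψ⟫_ℂ = 0 := by
  obtain ⟨h1, h2⟩ := hφ
  obtain ⟨h3, h4⟩ := hψ
  have h := inner_symm_of_isSelfAdjoint hA ⟨φ, h1⟩ ⟨ψ, h3⟩
  rw [h2, h4] at h
  simp only [inner_smul_left, inner_smul_right, Complex.conj_ofReal] at h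
  have h5 : ((s : ℂ) - t) * ⟪φ, ψ⟫_ℂ = 0 := by linear_combination h
  rcases mul_eq_zero.1 h5 with h6 | h6
  · exact absurd (by exact_mod_cast sub_eq_zero.1 h6) hst
  · exact h6

theorem orthogonalFamily_eigenspace (hA : IsSelfAdjoint A) :
    OrthogonalFamily ℂ (fun t : ℝ => eigenspace A t) fun t => (eigenspace A t).subtypeₗᵢ :=
  fun _ _ hst φ ψ => inner_eigenspace_eq_zero hA hst φ.2 ψ.2

/-- The domain of `A` is that of its adjoint, so a weak identity tested against the domain already
yields domain membership. -/
theorem mem_graph_of_isSelfAdjoint (hA : IsSelfAdjoint A) {x y : E}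
    (h : ∀ ψ : A.domain, ⟪y, (ψ : E)⟫_ℂ = ⟪x, A ψ⟫_ℂ) : ∃ hx : x ∈ A.domain, A ⟨x, hx⟩ = y := by
  have h1 : (x, y) ∈ A.adjoint.graph := by
    have hx : x ∈ A.adjoint.domain := LinearPMap.mem_adjoint_domain_of_exists x ⟨y, h⟩
    rw [LinearPMap.mem_graph_iff]
    exact ⟨⟨x, hx⟩, rfl, LinearPMap.adjoint_apply_eq hA.dense_domain ⟨x, hx⟩ h⟩
  rw [LinearPMap.isSelfAdjoint_def.mp hA, LinearPMap.mem_graph_iff] at h1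
  obtain ⟨w, h2, h3⟩ := h1
  have hx : x ∈ A.domain := by
    have h2' : (w : E) = x := h2
    exact h2' ▸ w.2
  have h4 : w = ⟨x, hx⟩ := Subtype.ext h2
  exact ⟨hx, by rw [← h4]; exact h3⟩

/-- In weak form the eigenvalue equation is a family of closed conditions on `x`. Closedness makes
the closure in `spectralProj A {t}` harmless, so that its range consists of true eigenvectors. -/
theorem isClosed_eigenspace (hA : IsSelfAdjoint A) (t : ℝ) :
    IsClosed (eigenspace A t : Set E) := by
  have h : (eigenspace A t : Set E) =
      ⋂ ψ : A.domain, {x : E | ⟪(t : ℂ) • x, (ψ : E)⟫_ℂ = ⟪x, A ψ⟫_ℂ} := by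
    ext x
    simp only [SetLike.mem_coe, Set.mem_iInter, Set.mem_ofPred_eq]
    constructor
    · rintro ⟨h1, h2⟩ ψ
      rw [← h2]
      exact inner_symm_of_isSelfAdjoint hA ⟨x, h1⟩ ψ
    · intro h
      exact mem_graph_of_isSelfAdjoint hA h
  rw [h]
  exact isClosed_iInter fun ψ => isClosed_eq (by fun_prop) (by fun_prop)

theorem spectralProj_singleton_mem (hA : IsSelfAdjoint A) (t : ℝ) (f : E) :
    spectralProj A {t} f ∈ eigenspace A t := by
  have h : (⨆ s ∈ ({t} : Set ℝ), eigenspace A s).topologicalClosure = eigenspace A t := by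
    simp only [Set.mem_singleton_iff, iSup_iSup_eq_left]
    exact (isClosed_eigenspace hA t).submodule_topologicalClosure_eq
  have h2 := Submodule.starProjection_apply_mem
    (⨆ s ∈ ({t} : Set ℝ), eigenspace A s).topologicalClosure f
  exact h ▸ h2

theorem spectralProj_singleton_eq_self {t : ℝ} {φ : E} (hφ : φ ∈ eigenspace A t) :
    spectralProj A {t} φ = φ := by
  apply Submodule.starProjection_eq_self_iff.2
  apply Submodule.le_topologicalClosure
  simpa using hφ

theorem inner_spectralProj_left (J : Set ℝ) (f g : E) :
    ⟪spectralProj A J f, g⟫_ℂ = ⟪f, spectralProj A J g⟫_ℂ :=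
  Submodule.inner_starProjection_left_eq_right _ f g

theorem inner_spectralProj_self (J : Set ℝ) (f : E) :
    ⟪f, spectralProj A J f⟫_ℂ = ((‖spectralProj A J f‖ ^ 2 : ℝ) : ℂ) := by
  have h : spectralProj A J (spectralProj A J f) = spectralProj A J f :=
    Submodule.starProjection_eq_self_iff.2 (Submodule.starProjection_apply_mem _ f)
  rw [← h, ← inner_spectralProj_left, h, inner_self_eq_norm_sq_to_K]
  simp

theorem norm_spectralProj_apply_le (J : Set ℝ) (f : E) : ‖spectralProj A J f‖ ≤ ‖f‖ :=
  (ContinuousLinearMap.le_opNorm _ _).trans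
    (mul_le_of_le_one_left (norm_nonneg _) (Submodule.starProjection_norm_le _))

theorem inner_sub_spectralProj_singleton {t : ℝ} {φ : E} (hφ : φ ∈ eigenspace A t) (f : E) :
    ⟪φ, f - spectralProj A {t} f⟫_ℂ = 0 := by
  rw [inner_sub_right, ← inner_spectralProj_left, spectralProj_singleton_eq_self hφ, sub_self]

open Classical in
theorem summable_spectralProj_singleton (hA : IsSelfAdjoint A) (f : E) (c : ℝ → ℂ)
    (hc : ∀ t, ‖c t‖ ≤ 1) : Summable fun t : ℝ => c t • spectralProj A {t} f := by
  have hV := orthogonalFamily_eigenspace hA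
  have hmem := fun t => spectralProj_singleton_mem hA t f
  have h := (hV.summable_iff_norm_sq_summable
    (fun t => c t • (⟨spectralProj A {t} f, hmem t⟩ : eigenspace A t))).2 ?_
  · simpa using h
  refine summable_of_sum_le (c := ‖f‖ ^ 2) (fun _ => by positivity) fun F => ?_
  have h1 : ∑ t ∈ F, ‖c t • (⟨spectralProj A {t} f, hmem t⟩ : eigenspace A t)‖ ^ 2 ≤
      ∑ t ∈ F, ‖(⟨spectralProj A {t} f, hmem t⟩ : eigenspace A t)‖ ^ 2 := by
    refine Finset.sum_le_sum fun t _ => ?_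
    rw [norm_smul, mul_pow]
    exact mul_le_of_le_one_left (by positivity) (pow_le_one₀ (norm_nonneg _) (hc t))
  refine h1.trans ?_
  have h2 := hV.norm_sum (fun t => (⟨spectralProj A {t} f, hmem t⟩ : eigenspace A t)) F
  rw [← h2]
  set v : E := ∑ t ∈ F, (eigenspace A t).subtypeₗᵢ ⟨spectralProj A {t} f, hmem t⟩ with hv
  -- Bessel's inequality: `⟪f, v⟫ = ‖v‖²` for the finite partial sum `v`, whence `‖v‖ ≤ ‖f‖` by
  -- Cauchy–Schwarz.
  have h3 : ⟪f, v⟫_ℂ = ((‖v‖ ^ 2 : ℝ) : ℂ) := by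
    rw [h2, hv, inner_sum]
    push_cast
    refine Finset.sum_congr rfl fun t _ => ?_
    have := inner_spectralProj_self (A := A) {t} f
    simpa using this
  have h4 : ‖v‖ ^ 2 ≤ ‖f‖ * ‖v‖ := by
    have := norm_inner_le_norm (𝕜 := ℂ) f v
    rw [h3, Complex.norm_real, Real.norm_of_nonneg (by positivity)] at this
    exact this
  nlinarith [norm_nonneg v, norm_nonneg f]

/-- The spectral projection is the sum of the projections onto the eigenspaces. -/
theorem hasSum_spectralProj (hA : IsSelfAdjoint A) (J : Set ℝ) (f : E) :
    HasSum (fun t : ℝ => J.indicator (fun t => spectralProj A {t} f) t) (spectralProj A J f) := by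
  have hs : Summable fun t : ℝ => J.indicator (fun t => spectralProj A {t} f) t := by
    have := summable_spectralProj_singleton hA f (J.indicator 1) fun t => by
      by_cases h : t ∈ J <;> simp [h]
    refine this.congr fun t => ?_
    by_cases h : t ∈ J <;> simp [h]
  obtain ⟨y, hy⟩ := hs
  suffices h : spectralProj A J f = y by rwa [h]
  have hle : ∀ t ∈ J, eigenspace A t ≤ ⨆ s ∈ J, eigenspace A s := fun t ht =>
    le_iSup₂_of_le t ht le_rfl
  apply Submodule.eq_starProjection_of_mem_of_inner_eq_zero
  · have hcl : IsClosed ((⨆ s ∈ J, eigenspace A s).topologicalClosure : Set E) :=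
      Submodule.isClosed_topologicalClosure _
    refine hcl.mem_of_tendsto hy (Eventually.of_forall fun F => ?_)
    refine Submodule.sum_mem _ fun t _ => ?_
    by_cases h : t ∈ J
    · rw [Set.indicator_of_mem h]
      exact Submodule.le_topologicalClosure _ (hle t h (spectralProj_singleton_mem hA t f))
    · rw [Set.indicator_of_notMem h]
      exact Submodule.zero_mem _
  · have key : (⨆ s ∈ J, eigenspace A s).topologicalClosure ≤ (ℂ ∙ (f - y))ᗮ := by
      refine Submodule.topologicalClosure_minimal _ (iSup₂_le fun t ht φ hφ => ?_)
        (Submodule.isClosed_orthogonal _)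
      rw [Submodule.mem_orthogonal_singleton_iff_inner_left]
      have h1 : HasSum (fun s : ℝ => ⟪φ, J.indicator (fun t => spectralProj A {t} f) s⟫_ℂ)
          ⟪φ, y⟫_ℂ := hy.mapL (innerSL ℂ φ)
      have h2 : HasSum (fun s : ℝ => ⟪φ, J.indicator (fun t => spectralProj A {t} f) s⟫_ℂ)
          ⟪φ, spectralProj A {t} f⟫_ℂ := by
        have := hasSum_single (f := fun s : ℝ =>
          ⟪φ, J.indicator (fun t => spectralProj A {t} f) s⟫_ℂ) t fun s hs => ?_
        · simpa [ht] using this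
        · by_cases h : s ∈ J
          · simp only [Set.indicator_of_mem h]
            exact inner_eigenspace_eq_zero hA (Ne.symm hs) hφ (spectralProj_singleton_mem hA s f)
          · simp [h]
      rw [inner_sub_right, h1.unique h2, ← inner_sub_right]
      exact inner_sub_spectralProj_singleton hφ f
    intro w hw
    have := key hw
    rw [Submodule.mem_orthogonal_singleton_iff_inner_right] at this
    exact this

theorem spectralProj_univ (hp : IsPurePoint A) (f : E) : spectralProj A Set.univ f = f := by
  have h : (⨆ s ∈ (Set.univ : Set ℝ), eigenspace A s).topologicalClosure = ⊤ := by
    simp only [Set.mem_univ, iSup_pos]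
    exact hp
  apply Submodule.starProjection_eq_self_iff.2
  rw [h]
  trivial

theorem hasSum_spectralProj_singleton (hA : IsSelfAdjoint A) (hp : IsPurePoint A) (f : E) :
    HasSum (fun t : ℝ => spectralProj A {t} f) f := by
  have := hasSum_spectralProj hA Set.univ f
  simpa [spectralProj_univ hp] using this

theorem hasSum_norm_sq_spectralProj (hA : IsSelfAdjoint A) (J : Set ℝ) (f : E) :
    HasSum (fun t : ℝ => J.indicator (fun t => ‖spectralProj A {t} f‖ ^ 2) t)
      (‖spectralProj A J f‖ ^ 2) := by
  have := ((hasSum_spectralProj hA J f).mapL (innerSL ℂ f))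
  simp only [innerSL_apply_apply] at this
  rw [inner_spectralProj_self] at this
  have h2 := Complex.hasSum_re this
  rw [Complex.ofReal_re] at h2
  convert h2 using 2 with t
  by_cases h : t ∈ J
  · simp only [Set.indicator_of_mem h]
    rw [inner_spectralProj_self, Complex.ofReal_re]
  · simp [h]

theorem enorm_sq_spectralProj (hA : IsSelfAdjoint A) (J : Set ℝ) (f : E) :
    ‖spectralProj A J f‖ₑ ^ 2 =
      ∑' t : ℝ, J.indicator (fun t => ‖spectralProj A {t} f‖ₑ ^ 2) t := by
  have h1 := hasSum_norm_sq_spectralProj hA J f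
  rw [enorm_sq_eq_ofReal, ← h1.tsum_eq, ENNReal.ofReal_tsum_of_nonneg _ h1.summable]
  · refine tsum_congr fun t => ?_
    by_cases h : t ∈ J
    · simp only [Set.indicator_of_mem h, enorm_sq_eq_ofReal]
    · simp [h]
  · intro t
    by_cases h : t ∈ J <;> simp [h]

/-! ### Resolvents -/

/-- `⟪φ, A φ⟫` is real, so the imaginary part of `⟪φ, (A - z) φ⟫` is `-(Im z) ‖φ‖²`; then
Cauchy–Schwarz. -/
theorem norm_le_of_sub_smul (hA : IsSelfAdjoint A) (z : ℂ) (φ : A.domain) :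
    |z.im| * ‖(φ : E)‖ ≤ ‖A φ - z • (φ : E)‖ := by
  have h1 : (⟪(φ : E), A φ - z • (φ : E)⟫_ℂ).im = -z.im * ‖(φ : E)‖ ^ 2 := by
    have hr : (⟪(φ : E), A φ⟫_ℂ).im = 0 := by
      have h := inner_symm_of_isSelfAdjoint hA φ φ
      have h' := inner_conj_symm (𝕜 := ℂ) (φ : E) (A φ)
      rw [h] at h'
      exact Complex.conj_eq_iff_im.1 h'
    rw [inner_sub_right, inner_smul_right, inner_self_eq_norm_sq_to_K, Complex.sub_im, hr]
    simp [← Complex.ofReal_pow]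
  have h2 : |z.im| * ‖(φ : E)‖ ^ 2 ≤ ‖(φ : E)‖ * ‖A φ - z • (φ : E)‖ := by
    have := (Complex.abs_im_le_norm _).trans (norm_inner_le_norm (𝕜 := ℂ) (φ : E) (A φ - z • (φ : E)))
    rw [h1, abs_mul, abs_neg, abs_of_nonneg (sq_nonneg ‖(φ : E)‖)] at this
    exact this
  rcases (norm_nonneg (φ : E)).eq_or_lt with h0 | h0
  · rw [← h0]; simp
  · nlinarith

/-- The solution is `∑ (t - z)⁻¹ P_t f`. It lies in the domain by the weak criterion
`mem_graph_of_isSelfAdjoint`, checked term by term. -/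
theorem exists_sub_smul_eq (hA : IsSelfAdjoint A) (hp : IsPurePoint A) {z : ℂ} (hz : z.im ≠ 0)
    (f : E) : ∃ φ : A.domain, A φ - z • (φ : E) = f := by
  have htz : ∀ t : ℝ, (t : ℂ) - z ≠ 0 := fun t h => hz (by
    have := congrArg Complex.im h
    simpa using this)
  have hs : Summable fun t : ℝ => ((t : ℂ) - z)⁻¹ • spectralProj A {t} f := by
    -- The factor `|Im z|` normalises the coefficients to modulus at most `1`; it is divided out
    -- afterwards.
    have h := summable_spectralProj_singleton hA f (fun t => ((|z.im| : ℝ) : ℂ) * ((t : ℂ) - z)⁻¹) ?_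
    · have h2 := h.const_smul (((|z.im| : ℝ) : ℂ)⁻¹)
      refine h2.congr fun t => ?_
      rw [smul_smul, inv_mul_cancel_left₀]
      simpa using hz
    · intro t
      rw [norm_mul, norm_inv, ← div_eq_mul_inv, div_le_one (norm_pos_iff.2 (htz t)),
        Complex.norm_real, Real.norm_eq_abs, abs_abs]
      have := Complex.abs_im_le_norm ((t : ℂ) - z)
      simpa using this
  obtain ⟨x, hx⟩ := hs
  have hf := hasSum_spectralProj_singleton hA hp f
  obtain ⟨h1, h2⟩ := mem_graph_of_isSelfAdjoint hA (x := x) (y := f + z • x) fun ψ => by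
    have e1 := (hf.add (hx.const_smul z)).mapL (innerSL ℂ (ψ : E))
    have e2 := hx.mapL (innerSL ℂ (A ψ))
    simp only [innerSL_apply_apply] at e1 e2
    have e3 : ⟪(ψ : E), f + z • x⟫_ℂ = ⟪A ψ, x⟫_ℂ := by
      refine e1.unique ?_
      convert e2 using 2 with t
      obtain ⟨h3, h4⟩ := spectralProj_singleton_mem hA t f
      have h5 := inner_symm_of_isSelfAdjoint hA ψ ⟨_, h3⟩
      rw [h4] at h5
      rw [inner_smul_right (A ψ), h5, inner_add_right, inner_smul_right, inner_smul_right,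
        inner_smul_right]
      field_simp [htz t]
      ring
    rw [← inner_conj_symm, e3, inner_conj_symm]
  exact ⟨⟨x, h1⟩, by rw [h2]; simp⟩

theorem exists_isResolventAt (hA : IsSelfAdjoint A) (hp : IsPurePoint A) {z : ℂ} (hz : z.im ≠ 0) :
    ∃ R, IsResolventAt A z R := by
  have h0 : 0 < |z.im| := abs_pos.2 hz
  choose g hg using exists_sub_smul_eq hA hp hz
  have huniq : ∀ φ ψ : A.domain, A φ - z • (φ : E) = A ψ - z • (ψ : E) → φ = ψ := by
    intro φ ψ h
    have h1 := norm_le_of_sub_smul hA z (φ - ψ)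
    have h2 : A (φ - ψ) - z • ((φ - ψ : A.domain) : E) = 0 := by
      rw [A.map_sub, Submodule.coe_sub, smul_sub, sub_sub_sub_comm, h, sub_self]
    rw [h2, norm_zero] at h1
    have h3 : ‖((φ - ψ : A.domain) : E)‖ = 0 :=
      le_antisymm (nonpos_of_mul_nonpos_right h1 h0) (norm_nonneg _)
    exact sub_eq_zero.1 (Subtype.ext (norm_eq_zero.1 h3))
  let L : E →ₗ[ℂ] E :=
    { toFun := fun f => (g f : E)
      map_add' := fun f f' => by
        have : g (f + f') = g f + g f' := huniq _ _ (by
          rw [hg, A.map_add, Submodule.coe_add, smul_add, add_sub_add_comm, hg, hg])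
        rw [this]; rfl
      map_smul' := fun c f => by
        have : g (c • f) = c • g f := huniq _ _ (by
          rw [hg, A.map_smul, Submodule.coe_smul, smul_comm z c, ← smul_sub, hg])
        rw [this]; rfl }
  refine ⟨L.mkContinuous (|z.im|⁻¹) fun f => ?_, fun f => ⟨(g f).2, hg f⟩, fun φ => ?_⟩
  · have h1 := norm_le_of_sub_smul hA z (g f)
    rw [hg] at h1
    change ‖(g f : E)‖ ≤ _
    rw [inv_mul_eq_div, le_div_iff₀ h0, mul_comm]
    exact h1
  · change (g (A φ - z • (φ : E)) : E) = φ
    rw [huniq _ φ (hg _)]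

theorem isResolventAt_resolventOp (hA : IsSelfAdjoint A) (hp : IsPurePoint A) {z : ℂ}
    (hz : z.im ≠ 0) : IsResolventAt A z (resolventOp A z) := by
  have h := exists_isResolventAt hA hp hz
  rw [resolventOp, dif_pos h]
  exact h.choose_spec

theorem resolventOp_apply_eigenvector (hA : IsSelfAdjoint A) (hp : IsPurePoint A) {z : ℂ}
    (hz : z.im ≠ 0) {t : ℝ} {φ : E} (hφ : φ ∈ eigenspace A t) :
    resolventOp A z φ = ((t : ℂ) - z)⁻¹ • φ := by
  obtain ⟨h1, h2⟩ := hφ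
  have h := (isResolventAt_resolventOp hA hp hz).2 ⟨φ, h1⟩
  have htz : (t : ℂ) - z ≠ 0 := fun h => hz (by
    have := congrArg Complex.im h
    simpa using this)
  rw [h2, ← sub_smul, map_smul] at h
  simp only at h
  nth_rewrite 2 [← h]
  rw [smul_smul, inv_mul_cancel₀ htz, one_smul]

end Spectral

/-! ### Measurability of spectral projections, derived from the resolvents. -/

section MeasurableFamilies

open Filter Topology

/-- Orthonormal vectors are `√2` apart, so balls of radius `1/2` around them are disjoint open sets
in a separable space. -/
theorem countable_of_hilbertBasis {E : Type*} [NormedAddCommGroup E] [InnerProductSpace ℂ E]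
    [SecondCountableTopology E] {ι : Type*} (b : HilbertBasis ι ℂ E) : Countable ι := by
  have hd : ∀ i j, i ≠ j → 1 ≤ dist (b i) (b j) := fun i j hij => by
    have h1 : ‖b i - b j‖ ^ 2 = 2 := by
      rw [@norm_sub_sq ℂ, b.orthonormal.1 i, b.orthonormal.1 j, b.orthonormal.2 hij]
      norm_num
    rw [dist_eq_norm]
    nlinarith [norm_nonneg (b i - b j)]
  have h : (Set.univ : Set ι).Countable := by
    refine Set.PairwiseDisjoint.countable_of_isOpen (s := fun i => Metric.ball (b i) (1 / 2)) ?_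
      (fun i _ => Metric.isOpen_ball) (fun i _ => ⟨b i, Metric.mem_ball_self (by norm_num)⟩)
    intro i _ j _ hij
    refine Metric.ball_disjoint_ball ?_
    have := hd i j hij
    linarith
  exact Set.countable_univ_iff.1 h

variable {E : Type*} [NormedAddCommGroup E] [InnerProductSpace ℂ E]
variable {W : Type*} [MeasurableSpace W]

theorem measurable_enorm_opNorm [SecondCountableTopology E] {F : Type*} [NormedAddCommGroup F]
    [InnerProductSpace ℂ F] {T : W → E →L[ℂ] F} (hT : ∀ g, Measurable fun ω => ‖T ω g‖ₑ) :
    Measurable fun ω => ‖T ω‖ₑ := by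
  obtain ⟨d, hd⟩ := TopologicalSpace.exists_dense_seq E
  -- A dense sequence determines the norm. A term with `d n = 0` reads `0 / 0 = 0` and does not
  -- affect the supremum.
  have h : ∀ S : E →L[ℂ] F, ‖S‖ₑ = ⨆ n, ‖S (d n)‖ₑ / ‖d n‖ₑ := by
    intro S
    have hle : ∀ f, ‖S f‖ₑ ≤ ‖S‖ₑ * ‖f‖ₑ := fun f => S.le_opENorm f
    refine le_antisymm ?_ (iSup_le fun n => ENNReal.div_le_of_le_mul (hle _))
    have hfin : (⨆ n, ‖S (d n)‖ₑ / ‖d n‖ₑ) ≠ ∞ := by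
      refine ne_top_of_le_ne_top (enorm_ne_top (x := S)) ?_
      exact iSup_le fun n => ENNReal.div_le_of_le_mul (hle _)
    set M := ⨆ n, ‖S (d n)‖ₑ / ‖d n‖ₑ with hM
    have hn : ∀ n, ‖S (d n)‖ ≤ M.toReal * ‖d n‖ := by
      intro n
      have h1 : ‖S (d n)‖ₑ ≤ M * ‖d n‖ₑ := by
        by_cases h0 : d n = 0
        · simp [h0]
        · rw [← ENNReal.div_le_iff (by simpa using h0) enorm_ne_top]
          exact le_iSup (fun n => ‖S (d n)‖ₑ / ‖d n‖ₑ) n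
      have := ENNReal.toReal_mono (ENNReal.mul_ne_top hfin enorm_ne_top) h1
      simpa using this
    have hall : ∀ f, ‖S f‖ ≤ M.toReal * ‖f‖ := fun f => by
      refine hd.induction_on f (isClosed_le (by fun_prop) (by fun_prop)) hn
    have := S.opNorm_le_bound ENNReal.toReal_nonneg hall
    rw [← ofReal_norm]
    exact (ENNReal.ofReal_le_iff_le_toReal hfin).2 this
  simp_rw [h]
  exact Measurable.iSup fun n => (hT _).div_const _

/-- `(g, ω) ↦ T ω g` is continuous in `g` and measurable in `ω`, hence jointly measurable. This is
what permits products of random operators. -/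
theorem stronglyMeasurable_clm_apply [SecondCountableTopology E] {T : W → E →L[ℂ] E} (hT : ∀ g, StronglyMeasurable fun ω => T ω g)
    {v : W → E} (hv : StronglyMeasurable v) : StronglyMeasurable fun ω => T ω (v ω) := by
  borelize E
  have h := stronglyMeasurable_uncurry_of_continuous_of_stronglyMeasurable
    (u := fun (g : E) (ω : W) => T ω g) (fun ω => (T ω).continuous) hT
  exact h.comp_measurable (hv.measurable.prodMk measurable_id)

/-- The iteration `X ↦ (3 X - X³) / 2`, which converges to the sign of the starting operator. -/
noncomputable def opSignIter (S : E →L[ℂ] E) : ℕ → E →L[ℂ] E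
  | 0 => S
  | n + 1 => (3 / 2 : ℂ) • opSignIter S n
      - (1 / 2 : ℂ) • (opSignIter S n ∘L opSignIter S n ∘L opSignIter S n)

/-- The iteration `x ↦ (3 x - x³) / 2`, which converges to the sign of `x ∈ [-1, 1]`. -/
noncomputable def realSignIter (x : ℝ) : ℕ → ℝ
  | 0 => x
  | n + 1 => (3 * realSignIter x n - realSignIter x n ^ 3) / 2

theorem opSignIter_apply {S : E →L[ℂ] E} {x : ℝ} {φ : E} (h : S φ = (x : ℂ) • φ) (n : ℕ) :
    opSignIter S n φ = (realSignIter x n : ℂ) • φ := by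
  induction n with
  | zero => exact h
  | succ n ih =>
    simp only [opSignIter, realSignIter, _root_.sub_apply,
      _root_.smul_apply, ContinuousLinearMap.comp_apply, ih, map_smul, smul_smul,
      ← sub_smul]
    congr 1
    push_cast
    ring

theorem stronglyMeasurable_opSignIter [SecondCountableTopology E] {S : W → E →L[ℂ] E}
    (hS : ∀ g, StronglyMeasurable fun ω => S ω g) (n : ℕ) (g : E) :
    StronglyMeasurable fun ω => opSignIter (S ω) n g := by
  induction n generalizing g with
  | zero => exact hS g
  | succ n ih =>
    simp only [opSignIter, _root_.sub_apply,
      _root_.smul_apply, ContinuousLinearMap.comp_apply]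
    exact ((ih g).const_smul _).sub ((stronglyMeasurable_clm_apply ih
      (stronglyMeasurable_clm_apply ih (ih g))).const_smul _)

theorem realSignIter_neg (x : ℝ) (n : ℕ) : realSignIter (-x) n = -realSignIter x n := by
  induction n with
  | zero => rfl
  | succ n ih => simp only [realSignIter, ih]; ring

theorem realSignIter_zero (n : ℕ) : realSignIter 0 n = 0 := by
  induction n with
  | zero => rfl
  | succ n ih => simp [realSignIter, ih]

/-- Each step multiplies the distance to `1` by `1 - (y + y²)/2`, which is at most `1 - x/2` because
the iterates stay above `x`. -/
theorem realSignIter_bounds {x : ℝ} (h0 : 0 ≤ x) (h1 : x ≤ 1) (n : ℕ) :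
    x ≤ realSignIter x n ∧ realSignIter x n ≤ 1 ∧ 1 - realSignIter x n ≤ (1 - x / 2) ^ n := by
  induction n with
  | zero => simp [realSignIter, h1, h0]
  | succ n ih =>
    obtain ⟨i1, i2, i3⟩ := ih
    simp only [realSignIter]
    set y := realSignIter x n
    have hy : 0 ≤ y := h0.trans i1
    refine ⟨?_, ?_, ?_⟩
    · nlinarith [mul_nonneg hy (mul_nonneg (sub_nonneg.2 i2) (by linarith : (0:ℝ) ≤ 1 + y))]
    · nlinarith [mul_nonneg (sq_nonneg (1 - y)) (by linarith : (0:ℝ) ≤ 2 + y)]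
    · have e : 1 - (3 * y - y ^ 3) / 2 = (1 - y) * (1 - (y + y ^ 2) / 2) := by ring
      rw [e, pow_succ]
      have : (1 - y) * (1 - (y + y ^ 2) / 2) ≤ (1 - y) * (1 - x / 2) := by
        refine mul_le_mul_of_nonneg_left ?_ (by linarith)
        nlinarith
      exact this.trans (mul_le_mul_of_nonneg_right i3 (by linarith))

theorem tendsto_realSignIter_pos {x : ℝ} (h0 : 0 < x) (h1 : x ≤ 1) :
    Tendsto (realSignIter x) atTop (𝓝 1) := by
  have h2 : Tendsto (fun n => 1 - (1 - x / 2) ^ n) atTop (𝓝 (1 - 0)) :=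
    (tendsto_pow_atTop_nhds_zero_of_lt_one (by linarith) (by linarith)).const_sub 1
  rw [sub_zero] at h2
  refine tendsto_of_tendsto_of_tendsto_of_le_of_le h2 tendsto_const_nhds (fun n => ?_) fun n => ?_
  · have := (realSignIter_bounds h0.le h1 n).2.2
    simp only
    linarith
  · exact (realSignIter_bounds h0.le h1 n).2.1

theorem abs_realSignIter_le {x : ℝ} (h : |x| ≤ 1) (n : ℕ) : |realSignIter x n| ≤ 1 := by
  have key : ∀ y : ℝ, 0 ≤ y → y ≤ 1 → |realSignIter y n| ≤ 1 := fun y h0 h1 => by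
    have := realSignIter_bounds h0 h1 n
    rw [abs_le]
    constructor <;> linarith
  obtain ⟨h1, h2⟩ := abs_le.1 h
  rcases le_total 0 x with h0 | h0
  · exact key x h0 h2
  · have := key (-x) (by linarith) (by linarith)
    rwa [realSignIter_neg, abs_neg] at this

/-- The polynomial `(y + y²)/2` sends the possible limits `1, 0, -1` to `1, 0, 0`. -/
theorem tendsto_indicator_of_realSignIter {x : ℝ} (h : |x| ≤ 1) :
    Tendsto (fun n => (realSignIter x n + realSignIter x n ^ 2) / 2) atTop
      (𝓝 (if 0 < x then 1 else 0)) := by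
  obtain ⟨h1, h2⟩ := abs_le.1 h
  rcases lt_trichotomy 0 x with h0 | h0 | h0
  · have := tendsto_realSignIter_pos h0 h2
    have h3 := (this.add (this.pow 2)).div_const 2
    rw [if_pos h0]
    convert h3 using 2
    norm_num
  · subst h0
    simp [realSignIter_zero]
  · have := tendsto_realSignIter_pos (x := -x) (by linarith) (by linarith)
    have h3 := (this.neg.add (this.pow 2)).div_const 2
    rw [if_neg h0.le.not_gt]
    convert h3 using 2
    · rw [realSignIter_neg]; ring
    · norm_num

variable [CompleteSpace E]

variable {A : E →ₗ.[ℂ] E}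

/-- Convergence of functions of `A` with a common bound, in quadratic form sense. -/
theorem tendsto_inner_of_acts (hA : IsSelfAdjoint A) (hp : IsPurePoint A) {U : ℕ → E →L[ℂ] E}
    {u : ℕ → ℝ → ℝ} (hU : ∀ n t, ∀ φ ∈ eigenspace A t, U n φ = (u n t : ℂ) • φ)
    (hu : ∀ n t, |u n t| ≤ 1) {J : Set ℝ}
    (hlim : ∀ t, Tendsto (fun n => u n t) atTop (𝓝 (J.indicator 1 t))) (g : E) :
    Tendsto (fun n => (⟪g, U n g⟫_ℂ).re) atTop (𝓝 (‖spectralProj A J g‖ ^ 2)) := by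
  have h1 : ∀ n, HasSum (fun t : ℝ => u n t * ‖spectralProj A {t} g‖ ^ 2) (⟪g, U n g⟫_ℂ).re := by
    intro n
    have h := ((hasSum_spectralProj_singleton hA hp g).mapL (U n)).mapL (innerSL ℂ g)
    have h2 := Complex.hasSum_re h
    simp only [innerSL_apply_apply] at h2
    convert h2 using 2 with t
    rw [hU n t _ (spectralProj_singleton_mem hA t g), inner_smul_right, inner_spectralProj_self,
      ← Complex.ofReal_mul, Complex.ofReal_re]
  have h2 := (hasSum_norm_sq_spectralProj hA J g).tsum_eq
  have h3 : Summable fun t : ℝ => ‖spectralProj A {t} g‖ ^ 2 := by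
    simpa using (hasSum_norm_sq_spectralProj hA Set.univ g).summable
  have h4 := tendsto_tsum_of_dominated_convergence (𝓕 := atTop)
    (f := fun n t => u n t * ‖spectralProj A {t} g‖ ^ 2)
    (g := fun t => J.indicator 1 t * ‖spectralProj A {t} g‖ ^ 2) h3
    (fun t => (hlim t).mul_const _) (Eventually.of_forall fun n t => ?_)
  · rw [← h2]
    convert h4 using 2 with n
    · exact (h1 n).tsum_eq.symm
    · refine tsum_congr fun t => ?_
      by_cases h : t ∈ J <;> simp [h]
  · rw [norm_mul, Real.norm_eq_abs, Real.norm_of_nonneg (by positivity)]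
    exact mul_le_of_le_one_left (by positivity) (hu n t)

/-- The spectral measure of `g` with respect to an operator with pure point spectrum. -/
noncomputable def specMeas (A : E →ₗ.[ℂ] E) (g : E) : Measure ℝ :=
  Measure.sum fun t : ℝ => ‖spectralProj A {t} g‖ₑ ^ 2 • Measure.dirac t

theorem specMeas_apply (hA : IsSelfAdjoint A) (g : E) {J : Set ℝ} (hJ : MeasurableSet J) :
    specMeas A g J = ‖spectralProj A J g‖ₑ ^ 2 := by
  rw [specMeas, Measure.sum_apply _ hJ, enorm_sq_spectralProj hA]
  refine tsum_congr fun t => ?_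
  rw [Measure.smul_apply, Measure.dirac_apply' _ hJ]
  by_cases h : t ∈ J <;> simp [h]

variable [SecondCountableTopology E] {B : W → E →ₗ.[ℂ] E}

theorem stronglyMeasurable_of_inner {v : W → E} (hv : ∀ f, Measurable fun ω => ⟪f, v ω⟫_ℂ) :
    StronglyMeasurable v := by
  obtain ⟨w, b, -⟩ := exists_hilbertBasis ℂ E
  have := countable_of_hilbertBasis b
  refine stronglyMeasurable_of_tendsto (u := atTop)
    (f := fun s : Finset w => fun ω => ∑ i ∈ s, b.repr (v ω) i • b i) (fun s => ?_) ?_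
  · refine Finset.stronglyMeasurable_fun_sum s fun i _ => ?_
    refine StronglyMeasurable.smul_const ?_ _
    simp_rw [b.repr_apply_apply]
    exact (hv (b i)).stronglyMeasurable
  · rw [tendsto_pi_nhds]
    exact fun ω => b.hasSum_repr (v ω)

theorem stronglyMeasurable_resolventOp (hm : IsMeasurableFamily ‹MeasurableSpace W› B) {z : ℂ}
    (hz : z.im ≠ 0) (g : E) : StronglyMeasurable fun ω => resolventOp (B ω) z g :=
  stronglyMeasurable_of_inner fun f => hm z hz f g

/-- The sum of the resolvents at `a + i` and `a - i` acts on eigenvectors as `2(t - a)/((t - a)² +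
1)`, a number in `[-1, 1]` with the sign of `t - a`. The sign iteration, a polynomial in this
bounded operator, therefore converges in quadratic form to the projection onto energies above `a`.
-/
theorem measurable_norm_sq_spectralProj_Ioi (hm : IsMeasurableFamily ‹MeasurableSpace W› B)
    (hA : ∀ ω, IsSelfAdjoint (B ω)) (hp : ∀ ω, IsPurePoint (B ω)) (a : ℝ) (g : E) :
    Measurable fun ω => ‖spectralProj (B ω) (Set.Ioi a) g‖ ^ 2 := by
  have hz1 : ((a : ℂ) + Complex.I).im ≠ 0 := by simp
  have hz2 : ((a : ℂ) - Complex.I).im ≠ 0 := by simp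
  let S : W → E →L[ℂ] E := fun ω =>
    resolventOp (B ω) (a + Complex.I) + resolventOp (B ω) (a - Complex.I)
  let x : ℝ → ℝ := fun t => 2 * (t - a) / ((t - a) ^ 2 + 1)
  have hS : ∀ ω t, ∀ φ ∈ eigenspace (B ω) t, S ω φ = (x t : ℂ) • φ := by
    intro ω t φ hφ
    simp only [S, x, _root_.add_apply]
    rw [resolventOp_apply_eigenvector (hA ω) (hp ω) hz1 hφ,
      resolventOp_apply_eigenvector (hA ω) (hp ω) hz2 hφ, ← add_smul]
    congr 1
    have e1 : (t : ℂ) - (a + Complex.I) ≠ 0 := fun h => by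
      have := congrArg Complex.im h
      simp at this
    have e2 : (t : ℂ) - (a - Complex.I) ≠ 0 := fun h => by
      have := congrArg Complex.im h
      simp at this
    have e3 : ((t - a) ^ 2 + 1 : ℂ) = (t - (a + Complex.I)) * (t - (a - Complex.I)) := by
      linear_combination Complex.I_sq
    push_cast
    rw [e3]
    field_simp
    ring
  have hx : ∀ t, |x t| ≤ 1 := fun t => by
    simp only [x]
    rw [abs_div, abs_of_pos (by positivity : (0:ℝ) < (t - a) ^ 2 + 1), div_le_one (by positivity),
      abs_le]
    constructor
    · nlinarith [sq_nonneg (t - a + 1)]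
    · nlinarith [sq_nonneg (t - a - 1)]
  let U : W → ℕ → E →L[ℂ] E := fun ω n =>
    (1 / 2 : ℂ) • (opSignIter (S ω) n + opSignIter (S ω) n ∘L opSignIter (S ω) n)
  have hU : ∀ ω n t, ∀ φ ∈ eigenspace (B ω) t,
      U ω n φ = (((realSignIter (x t) n + realSignIter (x t) n ^ 2) / 2 : ℝ) : ℂ) • φ := by
    intro ω n t φ hφ
    simp only [U, _root_.add_apply, _root_.smul_apply,
      ContinuousLinearMap.comp_apply, opSignIter_apply (hS ω t φ hφ), map_smul, smul_smul,
      ← add_smul]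
    congr 1
    push_cast
    ring
  have hlim := fun ω => tendsto_inner_of_acts (hA ω) (hp ω) (hU ω) (J := Set.Ioi a)
    (fun n t => by
      have := abs_le.1 (abs_realSignIter_le (hx t) n)
      rw [abs_le]
      constructor <;> nlinarith)
    (fun t => by
      have := tendsto_indicator_of_realSignIter (hx t)
      convert this using 2
      have : 0 < x t ↔ a < t := by
        simp only [x]
        rw [div_pos_iff_of_pos_right (by positivity)]
        constructor <;> intro h <;> linarith
      simp [Set.indicator_apply, this]) g
  refine measurable_of_tendsto_metrizable (fun n => ?_) (tendsto_pi_nhds.2 hlim)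
  have hSm : ∀ g, StronglyMeasurable fun ω => S ω g := fun g =>
    (stronglyMeasurable_resolventOp hm hz1 g).add (stronglyMeasurable_resolventOp hm hz2 g)
  have hI := stronglyMeasurable_opSignIter hSm n
  have hUm : StronglyMeasurable fun ω => U ω n g :=
    ((hI g).add (stronglyMeasurable_clm_apply hI (hI g))).const_smul _
  exact Complex.measurable_re.comp (stronglyMeasurable_const.inner hUm).measurable

theorem measurable_enorm_spectralProj (hm : IsMeasurableFamily ‹MeasurableSpace W› B)
    (hA : ∀ ω, IsSelfAdjoint (B ω)) (hp : ∀ ω, IsPurePoint (B ω)) {J : Set ℝ}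
    (hJ : MeasurableSet J) (g : E) : Measurable fun ω => ‖spectralProj (B ω) J g‖ₑ := by
  have hfin : ∀ ω, IsFiniteMeasure (specMeas (B ω) g) := fun ω => ⟨by
    rw [specMeas_apply (hA ω) g MeasurableSet.univ]
    exact ENNReal.pow_lt_top enorm_lt_top⟩
  -- Half-lines form a generating π-system, and the total mass `‖g‖²` does not depend on `ω`.
  have h : Measurable fun ω => specMeas (B ω) g := by
    refine Measurable.measure_of_isPiSystem
      (by rw [← borel_eq_generateFrom_Ioi]; exact BorelSpace.measurable_eq)
      isPiSystem_Ioi ?_ ?_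
    · rintro _ ⟨a, rfl⟩
      simp_rw [fun ω => specMeas_apply (hA ω) g (measurableSet_Ioi (a := a)), enorm_sq_eq_ofReal]
      exact (measurable_norm_sq_spectralProj_Ioi hm hA hp a g).ennreal_ofReal
    · simp_rw [fun ω => specMeas_apply (hA ω) g MeasurableSet.univ,
        fun ω => spectralProj_univ (hp ω) g]
      exact measurable_const
  have h2 : Measurable fun ω => (‖spectralProj (B ω) J g‖ₑ ^ 2) ^ (1 / 2 : ℝ) := by
    have h3 := Measure.measurable_coe hJ |>.comp h
    simp only [Function.comp_def, fun ω => specMeas_apply (hA ω) g hJ] at h3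
    exact h3.pow_const _
  convert h2 using 1
  ext ω
  rw [← ENNReal.rpow_natCast, ← ENNReal.rpow_mul]
  norm_num

end MeasurableFamilies

/-! ### The operators `χ_x`, local amplitudes and local traces. -/

section Localization

open Filter Topology

variable {D : ℕ}

instance (Ω : Set (Conf D)) : SecondCountableTopology (L2on Ω) :=
  have : Fact ((2 : ℝ≥0∞) ≠ ∞) := ⟨ENNReal.ofNat_ne_top⟩
  inferInstanceAs (SecondCountableTopology {f : L2 D // f ∈ L2on Ω})

theorem memLp_top_of_bounded {g : Conf D → ℝ} (hg : Measurable g) (hb : ∀ x, |g x| ≤ 1) :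
    MemLp (fun x => (g x : ℂ)) ∞ (volume : Measure (Conf D)) :=
  memLp_top_of_bound (Complex.measurable_ofReal.comp hg).aestronglyMeasurable 1
    (Eventually.of_forall fun x => by simpa using hb x)

theorem mulOn_coeFn {Ω : Set (Conf D)} {g : Conf D → ℝ} (hg : Measurable g) (hb : ∀ x, |g x| ≤ 1)
    (f : L2on Ω) : ((mulOn Ω g f : L2on Ω) : L2 D) =ᵐ[volume] fun x => (g x : ℂ) * (f : L2 D) x :=
  mulOp_coeFn (memLp_top_of_bounded hg hb) f

theorem norm_mulOn_le {Ω : Set (Conf D)} {g : Conf D → ℝ} (hg : Measurable g)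
    (hb : ∀ x, |g x| ≤ 1) (f : L2on Ω) : ‖mulOn Ω g f‖ ≤ ‖f‖ := by
  refine Lp.norm_le_norm_of_ae_le (f := (mulOn Ω g f : L2 D)) (g := (f : L2 D)) ?_
  filter_upwards [mulOn_coeFn hg hb f] with x hx
  rw [hx, norm_mul]
  exact mul_le_of_le_one_left (norm_nonneg _) (by simpa using hb x)

theorem inner_mulOn {Ω : Set (Conf D)} {g : Conf D → ℝ} (hg : Measurable g)
    (hb : ∀ x, |g x| ≤ 1) (f h : L2on Ω) : ⟪mulOn Ω g f, h⟫_ℂ = ⟪f, mulOn Ω g h⟫_ℂ := by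
  rw [Submodule.coe_inner, Submodule.coe_inner, L2.inner_def, L2.inner_def]
  refine integral_congr_ae ?_
  filter_upwards [mulOn_coeFn hg hb f, mulOn_coeFn hg hb h] with x h1 h2
  rw [h1, h2]
  simp only [RCLike.inner_apply, map_mul, Complex.conj_ofReal]
  ring

theorem measurable_indicator_ball (x : Conf D) :
    Measurable ((Metric.ball x (1 / 2)).indicator (1 : Conf D → ℝ)) :=
  measurable_one.indicator Metric.isOpen_ball.measurableSet

theorem abs_indicator_ball_le (x y : Conf D) :
    |(Metric.ball x (1 / 2)).indicator (1 : Conf D → ℝ) y| ≤ 1 := by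
  by_cases h : y ∈ Metric.ball x (1 / 2)
  · rw [Set.indicator_of_mem h]; simp
  · rw [Set.indicator_of_notMem h]; simp

theorem chi_coeFn {Ω : Set (Conf D)} (x : Conf D) (f : L2on Ω) :
    ((chi Ω x f : L2on Ω) : L2 D) =ᵐ[volume] (Metric.ball x (1 / 2)).indicator (f : L2 D) := by
  filter_upwards [mulOn_coeFn (measurable_indicator_ball x) (abs_indicator_ball_le x) f] with y hy
  rw [chi, hy]
  by_cases h : y ∈ Metric.ball x (1 / 2)
  · rw [Set.indicator_of_mem h, Set.indicator_of_mem h]; simp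
  · rw [Set.indicator_of_notMem h, Set.indicator_of_notMem h]; simp

theorem norm_chi_apply_le {Ω : Set (Conf D)} (x : Conf D) (f : L2on Ω) : ‖chi Ω x f‖ ≤ ‖f‖ :=
  norm_mulOn_le (measurable_indicator_ball x) (abs_indicator_ball_le x) f

theorem inner_chi {Ω : Set (Conf D)} (x : Conf D) (f h : L2on Ω) :
    ⟪chi Ω x f, h⟫_ℂ = ⟪f, chi Ω x h⟫_ℂ :=
  inner_mulOn (measurable_indicator_ball x) (abs_indicator_ball_le x) f h

theorem isSelfAdjoint_chi (Ω : Set (Conf D)) (x : Conf D) : IsSelfAdjoint (chi Ω x) :=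
  ContinuousLinearMap.isSelfAdjoint_iff_isSymmetric.2 fun f h => inner_chi x f h

theorem enorm_sq_eq_lintegral (f : L2 D) : ‖f‖ₑ ^ 2 = ∫⁻ x, ‖f x‖ₑ ^ 2 := by
  have h := eLpNorm_nnreal_pow_eq_lintegral (μ := (volume : Measure (Conf D))) (f := (f : Conf D → ℂ))
    (p := 2) (by norm_num)
  rw [Lp.enorm_def]
  simpa using h

/-- The open balls miss only points with a coordinate in `ℤ + 1/2`, a countable union of null
hyperplanes. -/
theorem ae_exists_mem_ball_lattice (D : ℕ) : ∀ᵐ x : Conf D,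
    ∃ z : Fin D → ℤ, x ∈ Metric.ball (fun i => (z i : ℝ)) (1 / 2) := by
  have h : ∀ᵐ x : Conf D, ∀ i : Fin D, ∀ n : ℤ, x i ≠ n + 1 / 2 := by
    rw [ae_all_iff]
    intro i
    rw [ae_all_iff]
    intro n
    exact compl_mem_ae_iff.2 (Measure.pi_hyperplane (fun _ : Fin D => (volume : Measure ℝ)) i _)
  filter_upwards [h] with x hx
  refine ⟨fun i => round (x i), ?_⟩
  rw [Metric.mem_ball, dist_pi_lt_iff (by norm_num)]
  intro i
  rw [Real.dist_eq]
  refine lt_of_le_of_ne (abs_sub_round (x i)) fun h => ?_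
  rcases (abs_eq (by norm_num)).1 h with h1 | h1
  · exact hx i (round (x i)) (by linarith)
  · exact hx i (round (x i) - 1) (by push_cast; linarith)

theorem enorm_sq_le_tsum_chi {Ω : Set (Conf D)} (f : L2on Ω) :
    ‖f‖ₑ ^ 2 ≤ ∑' z : Fin D → ℤ, ‖chi Ω (fun i => (z i : ℝ)) f‖ₑ ^ 2 := by
  have h1 : ∀ g : L2on Ω, ‖g‖ₑ ^ 2 = ∫⁻ x, ‖(g : L2 D) x‖ₑ ^ 2 := fun g =>
    enorm_sq_eq_lintegral (g : L2 D)
  simp_rw [h1]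
  rw [← lintegral_tsum fun z => ((Lp.stronglyMeasurable _).enorm.pow_const 2).aemeasurable]
  refine lintegral_mono_ae ?_
  have h2 : ∀ᵐ x : Conf D, ∀ z : Fin D → ℤ, ((chi Ω (fun i => (z i : ℝ)) f : L2on Ω) : L2 D) x =
      (Metric.ball (fun i => (z i : ℝ)) (1 / 2)).indicator (f : L2 D) x :=
    ae_all_iff.2 fun z => chi_coeFn _ f
  filter_upwards [h2, ae_exists_mem_ball_lattice D] with x hx ⟨z, hz⟩
  refine le_trans ?_ (ENNReal.le_tsum z)
  rw [hx z, Set.indicator_of_mem hz]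

/-- An `L²`-function supported in a union of balls is controlled through the operators `χ_v`. -/
theorem enorm_apply_le_sum {Ω : Set (Conf D)} (B : L2on Ω →L[ℂ] L2on Ω) (T : Finset (Conf D))
    (κ : L2on Ω) (hκ : ∀ᵐ x : Conf D, x ∉ ⋃ v ∈ T, Metric.ball v (1 / 2) → (κ : L2 D) x = 0) :
    ‖B κ‖ₑ ≤ (∑ v ∈ T, ‖B ∘L chi Ω v‖ₑ) * ‖κ‖ₑ := by
  classical
  induction T using Finset.induction_on generalizing κ with
  | empty =>
    have h0 : κ = 0 := by
      apply Subtype.ext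
      rw [ZeroMemClass.coe_zero, Lp.eq_zero_iff_ae_eq_zero]
      filter_upwards [hκ] with x hx
      exact hx (by simp)
    rw [h0, map_zero]
    exact le_of_eq_of_le (enorm_eq_zero.2 rfl) zero_le
  | insert v T hv ih =>
    -- Induction peels off one ball: `κ - χ_v κ` is supported in the remaining balls and has no
    -- larger norm.
    have hco : ((κ - chi Ω v κ : L2on Ω) : L2 D) =ᵐ[volume]
        (Metric.ball v (1 / 2))ᶜ.indicator (κ : L2 D) := by
      filter_upwards [chi_coeFn v κ, Lp.coeFn_sub (κ : L2 D) (chi Ω v κ : L2on Ω)] with x h1 h2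
      rw [Submodule.coe_sub, h2, Pi.sub_apply, h1]
      by_cases h : x ∈ Metric.ball v (1 / 2)
      · rw [Set.indicator_of_mem h, Set.indicator_of_notMem (not_not_intro h), sub_self]
      · rw [Set.indicator_of_notMem h, Set.indicator_of_mem h, sub_zero]
    have hle : ‖κ - chi Ω v κ‖ₑ ≤ ‖κ‖ₑ := by
      rw [← ofReal_norm, ← ofReal_norm]
      refine ENNReal.ofReal_le_ofReal ?_
      refine Lp.norm_le_norm_of_ae_le (f := ((κ - chi Ω v κ : L2on Ω) : L2 D)) (g := (κ : L2 D)) ?_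
      filter_upwards [hco] with x hx
      rw [hx]
      exact norm_indicator_le_norm_self _ _
    have h1 := ih (κ - chi Ω v κ) (by
      filter_upwards [hco, hκ] with x h1 h2 h3
      rw [h1]
      by_cases h : x ∈ Metric.ball v (1 / 2)
      · exact Set.indicator_of_notMem (not_not_intro h) _
      · rw [Set.indicator_of_mem h]
        refine h2 ?_
        simp only [Finset.mem_insert, Set.iUnion_iUnion_eq_or_left, Set.mem_union, not_or]
        exact ⟨h, h3⟩)
    have h2 : B κ = (B ∘L chi Ω v) κ + B (κ - chi Ω v κ) := by
      rw [map_sub, ContinuousLinearMap.comp_apply]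
      abel
    rw [h2, Finset.sum_insert hv, add_mul]
    refine (enorm_add_le _ _).trans (add_le_add (ContinuousLinearMap.le_opENorm _ _) (h1.trans ?_))
    gcongr

/-! ### Amplitudes and local traces -/

variable {Ω : Set (Conf D)} {A : L2on Ω →ₗ.[ℂ] L2on Ω}

/-- The amplitude `‖χ_x P_J(A)‖`. -/
noncomputable def amp (A : L2on Ω →ₗ.[ℂ] L2on Ω) (x : Conf D) (J : Set ℝ) : ℝ≥0∞ :=
  ‖chi Ω x ∘L spectralProj A J‖ₑ

/-- Taking the adjoint moves the projection to the left, where orthogonality of the eigenspaces can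
be used. -/
theorem amp_eq (x : Conf D) (J : Set ℝ) : amp A x J = ‖spectralProj A J ∘L chi Ω x‖ₑ := by
  have h1 : ContinuousLinearMap.adjoint (chi Ω x) = chi Ω x := isSelfAdjoint_chi Ω x
  have h2 : ContinuousLinearMap.adjoint (spectralProj A J) = spectralProj A J :=
    isSelfAdjoint_starProjection _
  have h : ContinuousLinearMap.adjoint (chi Ω x ∘L spectralProj A J) =
      spectralProj A J ∘L chi Ω x := by
    rw [ContinuousLinearMap.adjoint_comp, h1, h2]
  rw [amp, ← h, ← ofReal_norm, ← ofReal_norm, LinearIsometryEquiv.norm_map]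

theorem amp_le_of_enorm_apply_le {x : Conf D} {J : Set ℝ} {c : ℝ≥0∞}
    (h : ∀ f, ‖spectralProj A J (chi Ω x f)‖ₑ ≤ c * ‖f‖ₑ) : amp A x J ≤ c := by
  rw [amp_eq]
  exact ContinuousLinearMap.opENorm_le_bound _ h

theorem amp_le_one (x : Conf D) (J : Set ℝ) : amp A x J ≤ 1 := by
  refine amp_le_of_enorm_apply_le fun f => ?_
  rw [one_mul, ← ofReal_norm, ← ofReal_norm]
  exact ENNReal.ofReal_le_ofReal ((norm_spectralProj_apply_le _ _).trans (norm_chi_apply_le x f))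

theorem enorm_spectralProj_mono (hA : IsSelfAdjoint A) {J J' : Set ℝ} (h : J ⊆ J') (f : L2on Ω) :
    ‖spectralProj A J f‖ₑ ≤ ‖spectralProj A J' f‖ₑ := by
  rw [← ENNReal.pow_le_pow_left_iff two_ne_zero, enorm_sq_spectralProj hA,
    enorm_sq_spectralProj hA]
  exact ENNReal.tsum_le_tsum fun t => Set.indicator_le_indicator_of_subset h (fun _ => zero_le) t

theorem amp_mono (hA : IsSelfAdjoint A) (x : Conf D) {J J' : Set ℝ} (h : J ⊆ J') :
    amp A x J ≤ amp A x J' := by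
  refine amp_le_of_enorm_apply_le fun f => (enorm_spectralProj_mono hA h _).trans ?_
  rw [amp_eq]
  exact ContinuousLinearMap.le_opENorm (spectralProj A J' ∘L chi Ω x) f

theorem spectralProj_union (hA : IsSelfAdjoint A) {J J' : Set ℝ} (h : Disjoint J J') (f : L2on Ω) :
    spectralProj A (J ∪ J') f = spectralProj A J f + spectralProj A J' f := by
  refine (hasSum_spectralProj hA (J ∪ J') f).unique ?_
  rw [Set.indicator_union_of_disjoint h]
  exact (hasSum_spectralProj hA J f).add (hasSum_spectralProj hA J' f)

theorem amp_union_le (hA : IsSelfAdjoint A) (x : Conf D) {J J' : Set ℝ} (h : Disjoint J J') :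
    amp A x (J ∪ J') ≤ amp A x J + amp A x J' := by
  refine amp_le_of_enorm_apply_le fun f => ?_
  rw [spectralProj_union hA h, add_mul, amp_eq, amp_eq]
  exact (enorm_add_le _ _).trans (add_le_add
    (ContinuousLinearMap.le_opENorm (spectralProj A J ∘L chi Ω x) f)
    (ContinuousLinearMap.le_opENorm (spectralProj A J' ∘L chi Ω x) f))

/-- The trace is the squared Hilbert–Schmidt norm of `P_J χ_x`, so it dominates the squared
amplitude. -/
theorem localTrace_eq (x : Conf D) (J : Set ℝ) : localTrace A x J =
    ∑' e : (exists_hilbertBasis ℂ (L2on Ω)).choose,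
      ‖spectralProj A J (chi Ω x (e : L2on Ω))‖ₑ ^ 2 := by
  rw [localTrace, posTrace]
  refine tsum_congr fun e => ?_
  rw [ContinuousLinearMap.comp_apply, ContinuousLinearMap.comp_apply, ← inner_chi,
    inner_spectralProj_self, enorm_sq_eq_ofReal]
  simp only [RCLike.re_to_complex, Complex.ofReal_re]

/-- The trace is additive over the eigenvalues, which the amplitude is not; every decomposition into
cells relies on this. -/
theorem localTrace_eq_tsum (hA : IsSelfAdjoint A) (x : Conf D) (J : Set ℝ) :
    localTrace A x J = ∑' t : ℝ, J.indicator (fun t => localTrace A x {t}) t := by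
  simp_rw [localTrace_eq, enorm_sq_spectralProj hA J]
  rw [ENNReal.tsum_comm]
  refine tsum_congr fun t => ?_
  by_cases h : t ∈ J <;> simp [h]

theorem amp_sq_le_localTrace (x : Conf D) (J : Set ℝ) : amp A x J ^ 2 ≤ localTrace A x J := by
  obtain ⟨b, hb⟩ := (exists_hilbertBasis ℂ (L2on Ω)).choose_spec
  rw [localTrace_eq, amp_eq]
  have := enorm_sq_le_tsum b (spectralProj A J ∘L chi Ω x)
  simpa [hb] using this

/-- Any nonzero eigenvector has its whole squared norm spread over the unit cubes of the lattice. -/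
theorem one_le_tsum_amp_sq {t : ℝ} (h : spectralProj A {t} ≠ 0) :
    1 ≤ ∑' z : Fin D → ℤ, amp A (fun i => (z i : ℝ)) {t} ^ 2 := by
  obtain ⟨f, hf⟩ : ∃ f, spectralProj A {t} f ≠ 0 := by
    by_contra! h'
    exact h (ContinuousLinearMap.ext h')
  set φ := spectralProj A {t} f with hφ
  have hφ' : spectralProj A {t} φ = φ :=
    Submodule.starProjection_eq_self_iff.2 (Submodule.starProjection_apply_mem _ f)
  have h1 : ‖φ‖ₑ ^ 2 ≤ (∑' z : Fin D → ℤ, amp A (fun i => (z i : ℝ)) {t} ^ 2) * ‖φ‖ₑ ^ 2 := by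
    rw [← ENNReal.tsum_mul_right]
    refine (enorm_sq_le_tsum_chi φ).trans (ENNReal.tsum_le_tsum fun z => ?_)
    rw [← mul_pow]
    have := ContinuousLinearMap.le_opENorm
      (chi Ω (fun i => (z i : ℝ)) ∘L spectralProj A {t}) φ
    rw [ContinuousLinearMap.comp_apply, hφ'] at this
    exact pow_le_pow_left' this 2
  have h0 : ‖φ‖ₑ ^ 2 ≠ 0 := pow_ne_zero 2 (enorm_eq_zero.not.2 hf)
  have htop : ‖φ‖ₑ ^ 2 ≠ ∞ := ENNReal.pow_ne_top enorm_ne_top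
  have h2 := ENNReal.div_le_of_le_mul h1
  rwa [ENNReal.div_self h0 htop] at h2

/-- Outside the spectrum there are no eigenvectors, so those terms vanish and the index set no
longer depends on the operator. -/
theorem correlator_eq (hA : IsSelfAdjoint A) (I : Set ℝ) (x y : Conf D) :
    correlator A I x y = ∑' t : ℝ, I.indicator (fun t => amp A x {t} * amp A y {t}) t := by
  have h := tsum_subtype (spec A ∩ I) fun t => amp A x {t} * amp A y {t}
  refine h.trans (tsum_congr fun t => ?_)
  by_cases hI : t ∈ I
  · by_cases hs : t ∈ spec A
    · rw [Set.indicator_of_mem hI, Set.indicator_of_mem (Set.mem_inter hs hI)]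
    · rw [Set.indicator_of_mem hI, Set.indicator_of_notMem fun h => hs h.1]
      have h0 : spectralProj A {t} = 0 := by
        ext1 f
        by_contra hf
        exact hs (mem_spec_of_eigenvector (spectralProj_singleton_mem hA t f) hf)
      simp [amp, h0]
  · rw [Set.indicator_of_notMem hI, Set.indicator_of_notMem fun h => hI h.2]

/-! ### Measurability of amplitudes and traces -/

variable {W : Type*} [MeasurableSpace W] {B : W → L2on Ω →ₗ.[ℂ] L2on Ω}

theorem measurable_amp (hm : IsMeasurableFamily ‹MeasurableSpace W› B)
    (hA : ∀ ω, IsSelfAdjoint (B ω)) (hp : ∀ ω, IsPurePoint (B ω)) (x : Conf D) {J : Set ℝ}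
    (hJ : MeasurableSet J) : Measurable fun ω => amp (B ω) x J := by
  simp_rw [amp_eq]
  exact measurable_enorm_opNorm fun g => measurable_enorm_spectralProj hm hA hp hJ (chi Ω x g)

theorem measurable_localTrace (hm : IsMeasurableFamily ‹MeasurableSpace W› B)
    (hA : ∀ ω, IsSelfAdjoint (B ω)) (hp : ∀ ω, IsPurePoint (B ω)) (x : Conf D) {J : Set ℝ}
    (hJ : MeasurableSet J) : Measurable fun ω => localTrace (B ω) x J := by
  obtain ⟨b, hb⟩ := (exists_hilbertBasis ℂ (L2on Ω)).choose_spec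
  have := countable_of_hilbertBasis b
  simp_rw [localTrace_eq]
  exact Measurable.tsum fun e =>
    (measurable_enorm_spectralProj hm hA hp hJ (chi Ω x e)).pow_const 2

theorem measurable_enorm_chi_resolventOp (hm : IsMeasurableFamily ‹MeasurableSpace W› B) {z : ℂ}
    (hz : z.im ≠ 0) (x y : Conf D) :
    Measurable fun ω => ‖chi Ω x ∘L resolventOp (B ω) z ∘L chi Ω y‖ₑ := by
  refine measurable_enorm_opNorm fun g => ?_
  simp only [ContinuousLinearMap.comp_apply]
  exact ((chi Ω x).continuous.comp_stronglyMeasurable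
    (stronglyMeasurable_resolventOp hm hz (chi Ω y g))).enorm

end Localization

/-! ### Approximation of sums over atoms by sums over deterministic energy cells. -/

section Cells

open Filter Topology

/-- Dominated convergence for counting measure; the σ-algebra `⊤` makes every function measurable,
even on an uncountable index set such as `ℝ`. -/
theorem tendsto_tsum_of_dominated_ennreal {ι : Type*} {F : ℕ → ι → ℝ≥0∞} {f b : ι → ℝ≥0∞}
    (hb : ∑' i, b i ≠ ∞) (hF : ∀ n i, F n i ≤ b i)
    (hlim : ∀ i, Tendsto (fun n => F n i) atTop (𝓝 (f i))) :
    Tendsto (fun n => ∑' i, F n i) atTop (𝓝 (∑' i, f i)) := by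
  let _ : MeasurableSpace ι := ⊤
  have h := tendsto_lintegral_of_dominated_convergence (μ := Measure.count) (F := F) (f := f) b
    (fun n => measurable_from_top) (fun n => Eventually.of_forall (hF n))
    (by rwa [lintegral_count]) (Eventually.of_forall hlim)
  simpa only [lintegral_count] using h

theorem tsum_indicator_singleton {ι : Type*} (w : ι → ℝ≥0∞) (t : ι) :
    ∑' s, ({t} : Set ι).indicator w s = w t := by
  rw [tsum_eq_single t fun s hs => Set.indicator_of_notMem (s := {t}) hs w,
    Set.indicator_of_mem (Set.mem_singleton t)]

theorem le_rpow_half_of_sq_le {a b : ℝ≥0∞} (h : a ^ 2 ≤ b) : a ≤ b ^ (1 / 2 : ℝ) := by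
  have := ENNReal.rpow_le_rpow h (by norm_num : (0 : ℝ) ≤ 1 / 2)
  rw [← ENNReal.rpow_natCast, ← ENNReal.rpow_mul] at this
  simpa using this

/-- The pieces of `I` on which `⌊(n + 1) s⌋` is constant. -/
def cell (I : Set ℝ) (n : ℕ) (k : ℤ) : Set ℝ := I ∩ {s | ⌊((n : ℝ) + 1) * s⌋ = k}

variable {I : Set ℝ} {n : ℕ} {k : ℤ}

theorem cell_subset : cell I n k ⊆ I := Set.inter_subset_left

theorem mem_cell_floor {t : ℝ} (ht : t ∈ I) (n : ℕ) : t ∈ cell I n ⌊((n : ℝ) + 1) * t⌋ := ⟨ht, rfl⟩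

theorem abs_sub_lt_of_mem_cell {s t : ℝ} (hs : s ∈ cell I n k) (ht : t ∈ cell I n k) :
    |s - t| < 1 / ((n : ℝ) + 1) := by
  have h0 : (0 : ℝ) < (n : ℝ) + 1 := by positivity
  have h := Int.abs_sub_lt_one_of_floor_eq_floor (hs.2.trans ht.2.symm)
  rw [← mul_sub, abs_mul, abs_of_pos h0] at h
  rwa [lt_div_iff₀ h0, mul_comm]

theorem ordConnected_cell (hI : I.OrdConnected) : (cell I n k).OrdConnected := by
  refine hI.inter ⟨fun a ha b hb c hc => ?_⟩
  have h0 : (0 : ℝ) ≤ (n : ℝ) + 1 := by positivity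
  refine le_antisymm ?_ ?_
  · rw [← Set.mem_ofPred_eq.mp hb]
    exact Int.floor_mono (mul_le_mul_of_nonneg_left hc.2 h0)
  · rw [← Set.mem_ofPred_eq.mp ha]
    exact Int.floor_mono (mul_le_mul_of_nonneg_left hc.1 h0)

theorem tsum_indicator_cell (w : ℝ → ℝ≥0∞) (ρ : ℤ → ℝ≥0∞) (I : Set ℝ) (n : ℕ) :
    ∑' k, ρ k * ∑' t, (cell I n k).indicator w t =
      ∑' t, ρ ⌊((n : ℝ) + 1) * t⌋ * I.indicator w t := by
  simp_rw [← ENNReal.tsum_mul_left]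
  rw [ENNReal.tsum_comm]
  refine tsum_congr fun t => ?_
  rw [tsum_eq_single ⌊((n : ℝ) + 1) * t⌋ fun k hk => ?_]
  · by_cases h : t ∈ I
    · rw [Set.indicator_of_mem (mem_cell_floor h n), Set.indicator_of_mem h]
    · rw [Set.indicator_of_notMem (fun h' => h (cell_subset h')), Set.indicator_of_notMem h]
  · rw [Set.indicator_of_notMem (fun h' => hk h'.2.symm), mul_zero]

theorem tendsto_tsum_indicator_cell {w : ℝ → ℝ≥0∞} (hw : ∑' t, I.indicator w t ≠ ∞) {t : ℝ}
    (ht : t ∈ I) : Tendsto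
      (fun n : ℕ => ∑' s, (cell I n ⌊((n : ℝ) + 1) * t⌋).indicator w s) atTop (𝓝 (w t)) := by
  have h := tendsto_tsum_of_dominated_ennreal (f := fun s => ({t} : Set ℝ).indicator w s)
    (F := fun (n : ℕ) s => (cell I n ⌊((n : ℝ) + 1) * t⌋).indicator w s) hw
    (fun n s => Set.indicator_le_indicator_of_subset cell_subset (fun _ => zero_le) s) fun s => ?_
  · rwa [tsum_indicator_singleton] at h
  · by_cases hst : s = t
    · subst hst
      rw [Set.indicator_of_mem (Set.mem_singleton s)]
      refine tendsto_const_nhds.congr fun n => ?_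
      rw [Set.indicator_of_mem (mem_cell_floor ht n)]
    · rw [Set.indicator_of_notMem (s := {t}) hst]
      refine tendsto_const_nhds.congr' ?_
      have h0 : 0 < |s - t| := abs_pos.2 (sub_ne_zero.2 hst)
      have h1 := (tendsto_order.1 (tendsto_one_div_add_atTop_nhds_zero_nat (𝕜 := ℝ))).2 _ h0
      filter_upwards [h1] with n hn
      rw [Set.indicator_of_notMem]
      intro h2
      exact lt_asymm hn (abs_sub_lt_of_mem_cell h2 (mem_cell_floor ht n))

/-- Sums over the atoms as limits of sums over small cells. -/
theorem tendsto_tsum_cell {w : ℝ → ℝ≥0∞} (hw : ∑' t, I.indicator w t ≠ ∞) {Φ : Set ℝ → ℝ≥0∞}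
    (hΦ : ∀ J ⊆ I, Φ J ≤ ∑' t, J.indicator w t)
    (hlim : ∀ t ∈ I, Tendsto (fun n : ℕ => Φ (cell I n ⌊((n : ℝ) + 1) * t⌋)) atTop (𝓝 (Φ {t}))) :
    Tendsto (fun n => ∑' k, Φ (cell I n k)) atTop (𝓝 (∑' t, I.indicator (fun t => Φ {t}) t)) := by
  set m : Set ℝ → ℝ≥0∞ := fun J => ∑' t, J.indicator w t with hm
  have hmfin : ∀ J ⊆ I, m J ≠ ∞ := fun J hJ => ne_top_of_le_ne_top hw
    (ENNReal.tsum_le_tsum fun t => Set.indicator_le_indicator_of_subset hJ (fun _ => zero_le) t)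
  -- Distributing `Φ` of a cell over its atoms in proportion to `w` gives a sum over a fixed index
  -- set. The ratio `Φ / m` is at most `1`, so `w` itself is the dominating function.
  have hA : ∀ n, ∑' k, Φ (cell I n k) = ∑' t,
      Φ (cell I n ⌊((n : ℝ) + 1) * t⌋) / m (cell I n ⌊((n : ℝ) + 1) * t⌋) * I.indicator w t := by
    intro n
    rw [← tsum_indicator_cell w (fun k => Φ (cell I n k) / m (cell I n k)) I n]
    refine tsum_congr fun k => ?_
    by_cases h0 : m (cell I n k) = 0
    · have h1 : Φ (cell I n k) = 0 := le_antisymm ((hΦ _ cell_subset).trans h0.le) zero_le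
      rw [h1, ENNReal.zero_div, zero_mul]
    · exact (ENNReal.div_mul_cancel h0 (hmfin _ cell_subset)).symm
  simp_rw [hA]
  refine tendsto_tsum_of_dominated_ennreal hw (fun n t => ?_) fun t => ?_
  · exact mul_le_of_le_one_left zero_le (ENNReal.div_le_of_le_mul (by
      rw [one_mul]; exact hΦ _ cell_subset))
  · by_cases ht : t ∈ I
    · rw [Set.indicator_of_mem ht, Set.indicator_of_mem ht]
      have hwt : Φ {t} ≤ w t := by
        have := hΦ {t} (Set.singleton_subset_iff.2 ht)
        rwa [tsum_indicator_singleton] at this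
      have hwfin : w t ≠ ∞ := by
        refine ne_top_of_le_ne_top hw ?_
        have := ENNReal.le_tsum (f := fun t => I.indicator w t) t
        simpa only [Set.indicator_of_mem ht] using this
      by_cases h0 : w t = 0
      · have h1 : Φ {t} = 0 := le_antisymm (hwt.trans h0.le) zero_le
        simp [h0, h1]
      · have h2 := ENNReal.Tendsto.div (hlim t ht) (Or.inr h0)
          (tendsto_tsum_indicator_cell hw ht) (Or.inl hwfin)
        have h3 := ENNReal.Tendsto.mul_const (b := w t) h2 (Or.inr hwfin)
        rwa [ENNReal.div_mul_cancel h0 hwfin] at h3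
    · simp [ht]

end Cells

/-! ### Measurability of the correlator. -/

section Correlator

open Filter Topology

variable {D : ℕ} {Ω : Set (Conf D)} {A : L2on Ω →ₗ.[ℂ] L2on Ω} {I : Set ℝ}

/-- Removing `t` from its cell leaves an amplitude bounded by the square root of a trace, and that
trace tends to `0` by additivity and finiteness. -/
theorem tendsto_amp_cell (hA : IsSelfAdjoint A) {x : Conf D} (hI : localTrace A x I ≠ ∞) {t : ℝ}
    (ht : t ∈ I) : Tendsto (fun n : ℕ => amp A x (cell I n ⌊((n : ℝ) + 1) * t⌋)) atTop
      (𝓝 (amp A x {t})) := by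
  have h1 : Tendsto (fun n : ℕ => localTrace A x (cell I n ⌊((n : ℝ) + 1) * t⌋ \ {t})) atTop
      (𝓝 0) := by
    have hsum : ∑' s, I.indicator (fun s => ({t} : Set ℝ)ᶜ.indicator
        (fun s => localTrace A x {s}) s) s ≠ ∞ := by
      refine ne_top_of_le_ne_top hI ?_
      rw [localTrace_eq_tsum hA x I]
      refine ENNReal.tsum_le_tsum fun s => ?_
      refine Set.indicator_le_indicator ?_
      exact Set.indicator_le_self _ _ _
    have h := tendsto_tsum_indicator_cell hsum ht
    rw [Set.indicator_of_notMem (by simp)] at h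
    refine h.congr fun n => ?_
    rw [localTrace_eq_tsum hA x (_ \ _)]
    refine tsum_congr fun s => ?_
    rw [Set.indicator_indicator]
    rfl
  have h2 : Tendsto (fun n : ℕ => amp A x {t} +
      localTrace A x (cell I n ⌊((n : ℝ) + 1) * t⌋ \ {t}) ^ (1 / 2 : ℝ)) atTop
      (𝓝 (amp A x {t} + 0 ^ (1 / 2 : ℝ))) :=
    tendsto_const_nhds.add (h1.ennrpow_const _)
  rw [ENNReal.zero_rpow_of_pos (by norm_num), add_zero] at h2
  have hsub : ∀ n : ℕ, {t} ⊆ cell I n ⌊((n : ℝ) + 1) * t⌋ := fun n =>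
    Set.singleton_subset_iff.2 (mem_cell_floor ht n)
  refine tendsto_of_tendsto_of_tendsto_of_le_of_le tendsto_const_nhds h2
    (fun n => amp_mono hA x (hsub n)) fun n => ?_
  have h3 := amp_union_le hA x (J := {t}) (J' := cell I n ⌊((n : ℝ) + 1) * t⌋ \ {t})
    Set.disjoint_sdiff_right
  rw [Set.union_sdiff_cancel (hsub n)] at h3
  refine h3.trans (add_le_add le_rfl ?_)
  exact le_rpow_half_of_sq_le (amp_sq_le_localTrace x _)

variable {W : Type*} [MeasurableSpace W] {P : Measure W} {B : W → L2on Ω →ₗ.[ℂ] L2on Ω}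

/-- The case `j = 0` is the correlator; `j = 1` covers the fourfold products of the final summation.
-/
theorem aemeasurable_tsum_amp (hm : IsMeasurableFamily ‹MeasurableSpace W› B)
    (hA : ∀ ω, IsSelfAdjoint (B ω)) (hp : ∀ ω, IsPurePoint (B ω)) (hI : I.OrdConnected)
    (hfin : ∀ x, ∀ᵐ ω ∂P, localTrace (B ω) x I ≠ ∞) (x y u v : Conf D) (j : ℕ) :
    AEMeasurable (fun ω => ∑' t, I.indicator (fun t => amp (B ω) x {t} * amp (B ω) y {t} *
      (amp (B ω) u {t} * amp (B ω) v {t}) ^ j) t) P := by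
  refine aemeasurable_of_tendsto_metrizable_ae atTop
    (f := fun n ω => ∑' k, amp (B ω) x (cell I n k) * amp (B ω) y (cell I n k) *
      (amp (B ω) u (cell I n k) * amp (B ω) v (cell I n k)) ^ j) (fun n => ?_) ?_
  · refine Measurable.aemeasurable (Measurable.tsum fun k => ?_)
    have h : ∀ z, Measurable fun ω => amp (B ω) z (cell I n k) := fun z =>
      measurable_amp hm hA hp z (ordConnected_cell hI).measurableSet
    exact ((h x).mul (h y)).mul (((h u).mul (h v)).pow_const j)
  · filter_upwards [hfin x, hfin y, hfin u, hfin v] with ω hx hy hu hv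
    -- The dominating weight comes from `pq ≤ p² + q²`, with squared amplitudes below traces; the
    -- `j`-th power is at most `1`.
    refine tendsto_tsum_cell (Φ := fun J => amp (B ω) x J * amp (B ω) y J *
      (amp (B ω) u J * amp (B ω) v J) ^ j)
      (w := fun t => localTrace (B ω) x {t} + localTrace (B ω) y {t}) ?_ ?_ ?_
    · have : ∑' t, I.indicator (fun t => localTrace (B ω) x {t} + localTrace (B ω) y {t}) t =
          localTrace (B ω) x I + localTrace (B ω) y I := by
        rw [localTrace_eq_tsum (hA ω) x I, localTrace_eq_tsum (hA ω) y I, ← ENNReal.tsum_add]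
        refine tsum_congr fun t => ?_
        by_cases h : t ∈ I <;> simp [h]
      rw [this]
      exact ENNReal.add_ne_top.2 ⟨hx, hy⟩
    · intro J _
      have h1 : ∑' t, J.indicator (fun t => localTrace (B ω) x {t} + localTrace (B ω) y {t}) t =
          localTrace (B ω) x J + localTrace (B ω) y J := by
        rw [localTrace_eq_tsum (hA ω) x J, localTrace_eq_tsum (hA ω) y J, ← ENNReal.tsum_add]
        refine tsum_congr fun t => ?_
        by_cases h : t ∈ J <;> simp [h]
      rw [h1]
      have h2 : (amp (B ω) u J * amp (B ω) v J) ^ j ≤ 1 :=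
        pow_le_one₀ zero_le (mul_le_one' (amp_le_one u J) (amp_le_one v J))
      refine (mul_le_of_le_one_right zero_le h2).trans ?_
      refine le_trans ?_ (add_le_add (amp_sq_le_localTrace x J) (amp_sq_le_localTrace y J))
      rcases le_total (amp (B ω) x J) (amp (B ω) y J) with h | h
      · refine le_add_left ?_
        rw [sq]
        gcongr
      · refine le_add_right ?_
        rw [sq]
        gcongr
    · intro t ht
      have hne : ∀ z, amp (B ω) z {t} ≠ ∞ := fun z =>
        ne_top_of_le_ne_top ENNReal.one_ne_top (amp_le_one z _)
      have e1 := ENNReal.Tendsto.mul (tendsto_amp_cell (hA ω) hx ht) (Or.inr (hne y))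
        (tendsto_amp_cell (hA ω) hy ht) (Or.inr (hne x))
      have e2 := ENNReal.Tendsto.mul (tendsto_amp_cell (hA ω) hu ht) (Or.inr (hne v))
        (tendsto_amp_cell (hA ω) hv ht) (Or.inr (hne u))
      have e3 := ((ENNReal.continuous_pow j).tendsto _).comp e2
      exact ENNReal.Tendsto.mul e1
        (Or.inr (ENNReal.pow_ne_top (ENNReal.mul_ne_top (hne u) (hne v)))) e3
        (Or.inr (ENNReal.mul_ne_top (hne x) (hne y)))

end Correlator

/-! ### Coverings, and the passage from `Ω` to `Ω'`. -/

section Geometric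

open Filter Topology

variable {D : ℕ}

/-- A set covered by unit balls is covered by balls of radius `1/2` centered in the set. -/
theorem exists_half_ball_cover {Γ : Set (Conf D)} {T : Finset (Conf D)}
    (h : Γ ⊆ ⋃ v ∈ T, Metric.ball v 1) : ∃ T' : Finset (Conf D), (∀ v ∈ T', v ∈ Γ) ∧
      T'.card ≤ T.card * 4 ^ D ∧ Γ ⊆ ⋃ v ∈ T', Metric.ball v (1 / 2) := by
  classical
  -- Each unit ball splits into `4 ^ D` cubes of side `1/2`, and one point of `Γ` is kept per cube
  -- that meets `Γ`. Centres in `Γ` are needed because the lower bound on the distance to `u` is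
  -- known only there.
  let Q : Conf D × (Fin D → Fin 4) → Set (Conf D) := fun p =>
    {x | x ∈ Γ ∧ ∀ i, ⌊2 * (x i - p.1 i)⌋ = (p.2 i : ℤ) - 2}
  let f : Conf D × (Fin D → Fin 4) → Conf D := fun p => if hp : (Q p).Nonempty then hp.some else 0
  have hf : ∀ p, (Q p).Nonempty → f p ∈ Q p := fun p hp => by
    simp only [f, dif_pos hp]
    exact hp.some_mem
  refine ⟨((T ×ˢ Finset.univ).filter fun p => (Q p).Nonempty).image f, ?_, ?_, ?_⟩
  · intro v hv
    obtain ⟨p, hp, rfl⟩ := Finset.mem_image.1 hv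
    exact (hf p (Finset.mem_filter.1 hp).2).1
  · refine Finset.card_image_le.trans ((Finset.card_filter_le _ _).trans ?_)
    rw [Finset.card_product, Finset.card_univ, Fintype.card_fun, Fintype.card_fin, Fintype.card_fin]
  · intro x hx
    obtain ⟨v, hv, hxv⟩ := Set.mem_iUnion₂.1 (h hx)
    rw [Metric.mem_ball, dist_pi_lt_iff one_pos] at hxv
    have hb : ∀ i, 0 ≤ ⌊2 * (x i - v i)⌋ + 2 ∧ ⌊2 * (x i - v i)⌋ + 2 < 4 := by
      intro i
      have := hxv i
      rw [Real.dist_eq, abs_lt] at this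
      have h1 : (-2 : ℤ) ≤ ⌊2 * (x i - v i)⌋ := by
        rw [Int.le_floor]; push_cast; linarith
      have h2 : ⌊2 * (x i - v i)⌋ < 2 := by
        rw [Int.floor_lt]; push_cast; linarith
      omega
    let p : Conf D × (Fin D → Fin 4) :=
      (v, fun i => ⟨(⌊2 * (x i - v i)⌋ + 2).toNat, by have := hb i; omega⟩)
    have hxp : x ∈ Q p := ⟨hx, fun i => by
      have := hb i
      simp only [p]
      omega⟩
    have hfp := hf p ⟨x, hxp⟩
    refine Set.mem_iUnion₂.2 ⟨f p, ?_, ?_⟩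
    · exact Finset.mem_image_of_mem f (Finset.mem_filter.2
        ⟨Finset.mem_product.2 ⟨hv, Finset.mem_univ _⟩, ⟨x, hxp⟩⟩)
    · rw [Metric.mem_ball, dist_pi_lt_iff (by norm_num)]
      intro i
      have := Int.abs_sub_lt_one_of_floor_eq_floor ((hxp.2 i).trans (hfp.2 i).symm)
      rw [Real.dist_eq]
      have e : 2 * (x i - p.1 i) - 2 * (f p i - p.1 i) = 2 * (x i - f p i) := by ring
      rw [e, abs_mul, abs_two] at this
      linarith

theorem exists_half_ball_cover_of_isBounded {S : Set (Conf D)} (h : Bornology.IsBounded S) :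
    ∃ Z : Finset (Conf D), S ⊆ ⋃ v ∈ Z, Metric.ball v (1 / 2) := by
  obtain ⟨t, -, ht, hS⟩ := Metric.finite_approx_of_totallyBounded
    (h.isCompact_closure.totallyBounded.subset subset_closure) (1 / 2)
    (by norm_num)
  exact ⟨ht.toFinset, by simpa using hS⟩

variable {Ω Ω' : Set (Conf D)} {A : L2on Ω →ₗ.[ℂ] L2on Ω} {A' : L2on Ω' →ₗ.[ℂ] L2on Ω'}

theorem ae_eq_zero_of_notMem (hΩ : IsOpen Ω) (f : L2on Ω) :
    ∀ᵐ x : Conf D, x ∉ Ω → (f : L2 D) x = 0 := by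
  have := (mem_L2on (f : L2 D)).1 f.2
  rwa [ae_restrict_iff' hΩ.measurableSet.compl] at this

theorem enorm_eq_of_coe_eq {f : L2on Ω} {g : L2on Ω'} (h : (f : L2 D) = g) : ‖f‖ₑ = ‖g‖ₑ := by
  have : ‖(f : L2 D)‖ₑ = ‖(g : L2 D)‖ₑ := by rw [h]
  exact this

/-- The geometric resolvent estimate for eigenfunctions. -/
theorem amp_le_of_isLocalPair (hΩ : IsOpen Ω) (hΩ' : IsOpen Ω') (hA' : IsSelfAdjoint A')
    (hp' : IsPurePoint A') (hA : IsSelfAdjoint A) {ξ : Conf D → ℝ} (hξm : Measurable ξ)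
    (hξ : ∀ x, 0 ≤ ξ x ∧ ξ x ≤ 1) (hξ1 : ∀ x ∈ Ω' \ Gam Ω Ω', ξ x = 1) {C : Set ℝ → ℝ≥0}
    (hL : IsLocalPair A A' ξ C) {I : Set ℝ} (hI : IsBoundedInterval I) {u : Conf D}
    (hu : Metric.ball u (1 / 2) ∩ Ω ⊆ Ω' \ Gam Ω Ω') {T Z : Finset (Conf D)}
    (hT : Gam Ω Ω' ⊆ ⋃ v ∈ T, Metric.ball v (1 / 2)) (hZ : Ω' ⊆ ⋃ v ∈ Z, Metric.ball v (1 / 2))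
    {t : ℝ} (ht : t ∈ I) {z : ℂ} (hz : z.im ≠ 0) {ε : ℝ≥0∞} (hε : ‖(t : ℂ) - z‖ₑ ≤ ε) :
    amp A u {t} ≤ C I * ∑ v ∈ T, ‖chi Ω' u ∘L resolventOp A' z ∘L chi Ω' v‖ₑ +
      ε * ∑ v ∈ Z, ‖chi Ω' u ∘L resolventOp A' z ∘L chi Ω' v‖ₑ := by
  have hξa : ∀ x, |ξ x| ≤ 1 := fun x => by
    rw [abs_of_nonneg (hξ x).1]; exact (hξ x).2
  refine ContinuousLinearMap.opENorm_le_bound _ fun f => ?_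
  rw [ContinuousLinearMap.comp_apply]
  set φ := spectralProj A {t} f with hφ
  have hφf : ‖φ‖ₑ ≤ ‖f‖ₑ := by
    rw [← ofReal_norm, ← ofReal_norm]
    exact ENNReal.ofReal_le_ofReal (norm_spectralProj_apply_le _ _)
  obtain ⟨h1, h2⟩ := spectralProj_singleton_mem hA t f
  obtain ⟨hdom, hi, hii, hiii⟩ := hL
  obtain ⟨ψ, hψ, hAψ⟩ := hi ⟨φ, h1⟩
  have hcomm := hiii I hI t ht ⟨φ, h1⟩ h2
  have hii' := hii ⟨φ, h1⟩
  set q := commutator A ξ hdom ⟨φ, h1⟩ with hq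
  -- `κ = (A' - t) ξφ` equals the commutator `[A, ξ] φ`, because `A'` and `A` agree on `ξφ` and `A φ
  -- = t φ`.
  set κ : L2on Ω' := A' ψ - (t : ℂ) • (ψ : L2on Ω') with hκ
  have hκq : (κ : L2 D) = (q : L2on Ω) := by
    rw [hκ, hq, commutator, h2, map_smul, Submodule.coe_sub, Submodule.coe_smul, Submodule.coe_sub,
      Submodule.coe_smul, hψ, hAψ]
  have hψφ : ‖(ψ : L2on Ω')‖ₑ ≤ ‖φ‖ₑ := by
    rw [enorm_eq_of_coe_eq hψ, ← ofReal_norm, ← ofReal_norm]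
    exact ENNReal.ofReal_le_ofReal (norm_mulOn_le hξm hξa φ)
  have hκφ : ‖κ‖ₑ ≤ C I * ‖φ‖ₑ := by
    rw [enorm_eq_of_coe_eq hκq, ← ofReal_norm, ← ofReal_norm, ← ENNReal.ofReal_coe_nnreal,
      ← ENNReal.ofReal_mul (by positivity)]
    exact ENNReal.ofReal_le_ofReal hcomm
  have hχ : ‖chi Ω u φ‖ₑ = ‖chi Ω' u (ψ : L2on Ω')‖ₑ := by
    refine enorm_eq_of_coe_eq (Lp.ext ?_)
    have hψ' : (((ψ : L2on Ω') : L2 D) : Conf D → ℂ) =ᵐ[volume] fun x => (ξ x : ℂ) * (φ : L2 D) x := by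
      rw [hψ]
      exact mulOn_coeFn hξm hξa φ
    filter_upwards [chi_coeFn u φ, chi_coeFn u (ψ : L2on Ω'), hψ', ae_eq_zero_of_notMem hΩ φ]
      with x e1 e2 e3 e4
    rw [e1, e2]
    by_cases hx : x ∈ Metric.ball u (1 / 2)
    · rw [Set.indicator_of_mem hx, Set.indicator_of_mem hx, e3]
      by_cases hxΩ : x ∈ Ω
      · rw [hξ1 x (hu ⟨hx, hxΩ⟩), Complex.ofReal_one, one_mul]
      · rw [e4 hxΩ, mul_zero]
    · rw [Set.indicator_of_notMem hx, Set.indicator_of_notMem hx]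
  -- Moving the spectral parameter from `t` to `z` replaces an eigenvalue-dependent resolvent by one
  -- at a fixed point; the price is the term with `t - z`.
  have hres : (ψ : L2on Ω') =
      resolventOp A' z κ + ((t : ℂ) - z) • resolventOp A' z (ψ : L2on Ω') := by
    rw [← map_smul, ← map_add]
    have h3 : κ + ((t : ℂ) - z) • (ψ : L2on Ω') = A' ψ - z • (ψ : L2on Ω') := by
      rw [hκ, sub_smul]; abel
    rw [h3]
    exact ((isResolventAt_resolventOp hA' hp' hz).2 ψ).symm
  set B := chi Ω' u ∘L resolventOp A' z with hB
  have hb1 := enorm_apply_le_sum B T κ (by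
    have hqz := ae_eq_zero_of_notMem hΩ q
    rw [hκq]
    filter_upwards [hii', hqz] with x e1 e2 e3
    by_cases hx : x ∈ Ω
    · exact e1 ⟨hx, fun h => e3 (hT h)⟩
    · exact e2 hx)
  -- `Z` covers all of `Ω'`, and its size is uncontrolled; this is acceptable since the term carries
  -- the factor `ε`.
  have hb2 := enorm_apply_le_sum B Z (ψ : L2on Ω') (by
    filter_upwards [ae_eq_zero_of_notMem hΩ' (ψ : L2on Ω')] with x e1 e2
    exact e1 fun h => e2 (hZ h))
  have hsum : chi Ω' u (ψ : L2on Ω') = B κ + ((t : ℂ) - z) • B (ψ : L2on Ω') := by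
    conv_lhs => rw [hres]
    rw [map_add, map_smul]
    rfl
  rw [hχ, hsum]
  calc ‖B κ + ((t : ℂ) - z) • B (ψ : L2on Ω')‖ₑ
      ≤ ‖B κ‖ₑ + ‖(t : ℂ) - z‖ₑ * ‖B (ψ : L2on Ω')‖ₑ := by
        rw [← enorm_smul]; exact enorm_add_le _ _
    _ ≤ (∑ v ∈ T, ‖B ∘L chi Ω' v‖ₑ) * (C I * ‖f‖ₑ) +
        ε * ((∑ v ∈ Z, ‖B ∘L chi Ω' v‖ₑ) * ‖f‖ₑ) := by
        gcongr
        · exact hb1.trans (by gcongr; exact hκφ.trans (by gcongr))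
        · exact hb2.trans (by gcongr; exact hψφ.trans hφf)
    _ = _ := by
        simp only [hB, ContinuousLinearMap.comp_assoc]
        ring

end Geometric

/-! ### Use of a bound on a conditional expectation. -/

section Conditional

variable {W : Type*} {m mW : MeasurableSpace W} {P : Measure W} [IsProbabilityMeasure P]

/-- Integration against a function with bounded conditional expectation. -/
theorem lintegral_mul_le_of_condLExp_le (hm : m ≤ mW) {X g : W → ℝ≥0∞} (hX : Measurable X)
    (hg : Measurable[m] g) {c : ℝ≥0∞} (h : condLExp m P X ≤ᵐ[P] fun _ => c) :
    ∫⁻ ω, g ω * X ω ∂P ≤ c * ∫⁻ ω, g ω ∂P := by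
  -- The conditional bound is an inequality between measures on `m`, against which the
  -- `m`-measurable `g` can be integrated.
  have hle : (P.withDensity X).trim hm ≤ c • P.trim hm := by
    refine Measure.le_iff.2 fun s hs => ?_
    rw [Measure.smul_apply, trim_measurableSet_eq hm hs, trim_measurableSet_eq hm hs,
      withDensity_apply _ (hm s hs), ← setLIntegral_condLExp hm P X hs, smul_eq_mul]
    calc ∫⁻ ω in s, condLExp m P X ω ∂P ≤ ∫⁻ _ in s, c ∂P :=
          lintegral_mono_ae (ae_restrict_of_ae h)
      _ = c * P s := by rw [setLIntegral_const]
  calc ∫⁻ ω, g ω * X ω ∂P = ∫⁻ ω, g ω ∂(P.withDensity X) := by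
        rw [lintegral_withDensity_eq_lintegral_mul _ hX (hg.mono hm le_rfl)]
        simp_rw [Pi.mul_apply, mul_comm]
    _ = ∫⁻ ω, g ω ∂((P.withDensity X).trim hm) := (lintegral_trim hm hg).symm
    _ ≤ ∫⁻ ω, g ω ∂(c • P.trim hm) := lintegral_mono' hle le_rfl
    _ = c * ∫⁻ ω, g ω ∂P := by rw [lintegral_smul_measure, lintegral_trim hm hg, smul_eq_mul]

end Conditional

/-! ### The moment bound obtained by discretising the energy. -/

section MomentBound

open Filter Topology

variable {D : ℕ} {W : Type*} {m mW : MeasurableSpace W} {P : Measure W} [IsProbabilityMeasure P]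

theorem rpow_sum_le_sum_rpow {ι : Type*} (T : Finset ι) (f : ι → ℝ≥0∞) {s : ℝ} (h0 : 0 < s)
    (h1 : s ≤ 1) : (∑ i ∈ T, f i) ^ s ≤ ∑ i ∈ T, f i ^ s :=
  Finset.le_sum_of_subadditive (fun a : ℝ≥0∞ => a ^ s) (by simp [h0])
    (fun a b => ENNReal.rpow_add_le_add_rpow a b h0.le h1) T f

theorem tsum_volume_cell {I : Set ℝ} (hI : I.OrdConnected) (n : ℕ) :
    ∑' k, volume (cell I n k) = volume I := by
  rw [← measure_iUnion ?_ fun k => (ordConnected_cell hI).measurableSet]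
  · congr 1
    ext t
    simp only [Set.mem_iUnion]
    exact ⟨fun ⟨k, hk⟩ => cell_subset hk, fun ht => ⟨_, mem_cell_floor ht n⟩⟩
  · intro k l hkl
    refine Set.disjoint_left.2 fun t hk hl => hkl ?_
    exact hk.2.symm.trans hl.2

/-- The key moment bound at fixed resolution `1 / (n + 1)` of the energy interval. -/
theorem lintegral_tsum_amp_sq_le {Ω Ω' : Set (Conf D)} (hm : m ≤ mW)
    (hΩ : IsOpen Ω) (hΩ' : IsOpen Ω')
    {B : W → L2on Ω →ₗ.[ℂ] L2on Ω} {B' : W → L2on Ω' →ₗ.[ℂ] L2on Ω'}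
    (hB : ∀ ω, IsSelfAdjoint (B ω)) (hBp : ∀ ω, IsPurePoint (B ω)) (hBm : IsMeasurableFamily mW B)
    (hB' : ∀ ω, IsSelfAdjoint (B' ω)) (hBp' : ∀ ω, IsPurePoint (B' ω))
    (hBm' : IsMeasurableFamily m B') {I : Set ℝ} (hI : IsBoundedInterval I)
    {ξ : Conf D → ℝ} (hξm : Measurable ξ)
    (hξ : ∀ x, 0 ≤ ξ x ∧ ξ x ≤ 1) (hξ1 : ∀ x ∈ Ω' \ Gam Ω Ω', ξ x = 1) {C : Set ℝ → ℝ≥0}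
    (hL : ∀ᵐ ω ∂P, IsLocalPair (B ω) (B' ω) ξ C) {u w : Conf D}
    (hu : Metric.ball u (1 / 2) ∩ Ω ⊆ Ω' \ Gam Ω Ω') {T Z : Finset (Conf D)}
    (hT : Gam Ω Ω' ⊆ ⋃ v ∈ T, Metric.ball v (1 / 2)) (hZ : Ω' ⊆ ⋃ v ∈ Z, Metric.ball v (1 / 2))
    {c : ℝ≥0∞} (hc : ∀ J ⊆ I, J.OrdConnected →
      condLExp m P (fun ω => localTrace (B ω) w J) ≤ᵐ[P] fun _ => c * volume J)
    {s : ℝ} (hs0 : 0 < s) (hs1 : s < 1) {a b : ℝ≥0∞}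
    (ha : ∀ v ∈ T, ∀ z : ℂ, z.re ∈ I → 0 < |z.im| → |z.im| < 1 →
      ∫⁻ ω, ‖chi Ω' u ∘L resolventOp (B' ω) z ∘L chi Ω' v‖ₑ ^ s ∂P ≤ a)
    (hb : ∀ v ∈ Z, ∀ z : ℂ, z.re ∈ I → 0 < |z.im| → |z.im| < 1 →
      ∫⁻ ω, ‖chi Ω' u ∘L resolventOp (B' ω) z ∘L chi Ω' v‖ₑ ^ s ∂P ≤ b) (n : ℕ) :
    ∫⁻ ω, ∑' t, I.indicator (fun t => amp (B ω) u {t} ^ 2 * amp (B ω) w {t} ^ 2) t ∂P ≤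
      c * volume I * ((C I : ℝ≥0∞) ^ s * (T.card * a) +
        ENNReal.ofReal (2 * (1 / ((n : ℝ) + 1))) ^ s * (Z.card * b)) := by
  classical
  set ε : ℝ≥0∞ := ENNReal.ofReal (2 * (1 / ((n : ℝ) + 1))) with hε
  -- With `n + 2` the imaginary part is below `1` even for `n = 0`, as the moment hypothesis
  -- requires, and still at most the mesh `1 / (n + 1)`; together they give `ε = 2 / (n + 1)`.
  let η : ℝ := 1 / ((n : ℝ) + 2)
  have hη0 : 0 < η := by positivity
  have hη1 : η < 1 := by
    simp only [η]
    rw [div_lt_one (by positivity)]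
    have : (0 : ℝ) ≤ n := by positivity
    linarith
  have hηn : η ≤ 1 / ((n : ℝ) + 1) := by
    simp only [η]
    gcongr
    norm_num
  -- The real part is chosen in the cell, hence in `I`, and independently of `ω`, so that the
  -- resolvent at `z k` stays `m`-measurable.
  let e : ℤ → ℝ := fun k => if h : (cell I n k).Nonempty then h.some else 0
  have he : ∀ k, (cell I n k).Nonempty → e k ∈ cell I n k := fun k h => by
    simp only [e, dif_pos h]
    exact h.some_mem
  let z : ℤ → ℂ := fun k => ⟨e k, η⟩
  let r : ℤ → Conf D → W → ℝ≥0∞ := fun k v ω =>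
    ‖chi Ω' u ∘L resolventOp (B' ω) (z k) ∘L chi Ω' v‖ₑ
  have hr : ∀ k v, Measurable[m] (r k v) := fun k v =>
    @measurable_enorm_chi_resolventOp D Ω' W m B' hBm' (z k) hη0.ne' u v
  have hrs : ∀ k v, Measurable[m] fun ω => r k v ω ^ s := fun k v => (hr k v).pow_const s
  let G : ℤ → W → ℝ≥0∞ := fun k ω =>
    (C I : ℝ≥0∞) ^ s * ∑ v ∈ T, r k v ω ^ s + ε ^ s * ∑ v ∈ Z, r k v ω ^ s
  have hGm : ∀ k, Measurable[m] (G k) := fun k =>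
    ((Finset.measurable_fun_sum T fun v _ => hrs k v).const_mul _).add
      ((Finset.measurable_fun_sum Z fun v _ => hrs k v).const_mul _)
  set M : ℝ≥0∞ := (C I : ℝ≥0∞) ^ s * (T.card * a) + ε ^ s * (Z.card * b) with hM
  have hGint : ∀ k, (cell I n k).Nonempty → ∫⁻ ω, G k ω ∂P ≤ M := by
    intro k hk
    have hrm : ∀ v, Measurable fun ω => r k v ω ^ s := fun v => (hrs k v).mono hm le_rfl
    have hzI : (z k).re ∈ I := cell_subset (he k hk)
    have hz0 : 0 < |(z k).im| := abs_pos.2 hη0.ne'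
    have hz1 : |(z k).im| < 1 := by
      simp only [z]
      rwa [abs_of_pos hη0]
    have hsum : ∀ (S : Finset (Conf D)) (q : ℝ≥0∞), (∀ v ∈ S, ∫⁻ ω, r k v ω ^ s ∂P ≤ q) →
        ∫⁻ ω, ∑ v ∈ S, r k v ω ^ s ∂P ≤ S.card * q := by
      intro S q hq
      rw [lintegral_finsetSum S fun v _ => hrm v, ← nsmul_eq_mul]
      exact Finset.sum_le_card_nsmul S _ _ hq
    have hmS : ∀ S : Finset (Conf D), Measurable fun ω => ∑ v ∈ S, r k v ω ^ s := fun S =>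
      Finset.measurable_fun_sum S fun v _ => hrm v
    simp only [G]
    rw [lintegral_add_left ((hmS T).const_mul _), lintegral_const_mul _ (hmS T),
      lintegral_const_mul _ (hmS Z), hM]
    gcongr
    · exact hsum T a fun v hv => ha v hv (z k) hzI hz0 hz1
    · exact hsum Z b fun v hv => hb v hv (z k) hzI hz0 hz1
  have hpt : ∀ᵐ ω ∂P, ∑' t, I.indicator (fun t => amp (B ω) u {t} ^ 2 * amp (B ω) w {t} ^ 2) t ≤
      ∑' k, G k ω * localTrace (B ω) w (cell I n k) := by
    filter_upwards [hL] with ω hω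
    simp_rw [fun k => localTrace_eq_tsum (hB ω) w (cell I n k)]
    rw [tsum_indicator_cell (fun t => localTrace (B ω) w {t}) (fun k => G k ω) I n]
    refine ENNReal.tsum_le_tsum fun t => ?_
    by_cases ht : t ∈ I
    · rw [Set.indicator_of_mem ht, Set.indicator_of_mem ht]
      refine mul_le_mul' ?_ (amp_sq_le_localTrace w {t})
      set k := ⌊((n : ℝ) + 1) * t⌋ with hk
      have htk : t ∈ cell I n k := mem_cell_floor ht n
      have hd : ‖(t : ℂ) - z k‖ₑ ≤ ε := by
        rw [← ofReal_norm, hε]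
        refine ENNReal.ofReal_le_ofReal ?_
        have h1 := abs_sub_lt_of_mem_cell htk (he k ⟨t, htk⟩)
        refine (Complex.norm_le_abs_re_add_abs_im _).trans ?_
        have e1 : ((t : ℂ) - z k).re = t - e k := by simp [z]
        have e2 : ((t : ℂ) - z k).im = -η := by simp [z]
        rw [e1, e2, abs_neg, abs_of_pos hη0]
        linarith
      have h2 := amp_le_of_isLocalPair hΩ hΩ' (hB' ω) (hBp' ω) (hB ω) hξm hξ hξ1 hω hI hu hT hZ ht
        (z := z k) hη0.ne' hd
      -- The amplitude is at most `1` and `s < 2`, so the square may be lowered to the exponent `s`.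
      calc amp (B ω) u {t} ^ 2 = amp (B ω) u {t} ^ (2 : ℝ) := by norm_cast
        _ ≤ amp (B ω) u {t} ^ s :=
            ENNReal.rpow_le_rpow_of_exponent_ge (amp_le_one _ _) (by linarith)
        _ ≤ (C I * ∑ v ∈ T, r k v ω + ε * ∑ v ∈ Z, r k v ω) ^ s :=
            ENNReal.rpow_le_rpow h2 hs0.le
        _ ≤ (C I * ∑ v ∈ T, r k v ω) ^ s + (ε * ∑ v ∈ Z, r k v ω) ^ s :=
            ENNReal.rpow_add_le_add_rpow _ _ hs0.le hs1.le
        _ ≤ G k ω := by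
            rw [ENNReal.mul_rpow_of_nonneg _ _ hs0.le, ENNReal.mul_rpow_of_nonneg _ _ hs0.le]
            simp only [G]
            gcongr <;> exact rpow_sum_le_sum_rpow _ _ hs0 hs1.le
    · rw [Set.indicator_of_notMem ht, Set.indicator_of_notMem ht, mul_zero]
  have hτm : ∀ k, Measurable fun ω => localTrace (B ω) w (cell I n k) := fun k =>
    measurable_localTrace hBm hB hBp w (ordConnected_cell hI.1).measurableSet
  calc _ ≤ ∫⁻ ω, ∑' k, G k ω * localTrace (B ω) w (cell I n k) ∂P := lintegral_mono_ae hpt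
    _ = ∑' k, ∫⁻ ω, G k ω * localTrace (B ω) w (cell I n k) ∂P :=
        lintegral_tsum fun k => (((hGm k).mono hm le_rfl).mul (hτm k)).aemeasurable
    _ ≤ ∑' k, c * volume (cell I n k) * M := by
        refine ENNReal.tsum_le_tsum fun k => ?_
        have h1 := lintegral_mul_le_of_condLExp_le hm (hτm k) (hGm k)
          (hc _ cell_subset (ordConnected_cell hI.1))
        -- For an empty cell `e k = 0` may lie outside `I` and the bound on `G k` is unavailable,
        -- but the factor `volume ∅ = 0` suffices.
        rcases Set.eq_empty_or_nonempty (cell I n k) with h0 | h0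
        · rw [h0, measure_empty, mul_zero, zero_mul] at h1 ⊢
          exact h1
        · exact h1.trans (by gcongr; exact hGint k h0)
    _ = c * volume I * M := by
        rw [ENNReal.tsum_mul_right, ENNReal.tsum_mul_left, tsum_volume_cell hI.1]

end MomentBound

/-! ### Growth and summability estimates for the pseudo-metric. -/

section PseudoMetric

open Filter Topology

variable {D : ℕ} {md : Conf D → Conf D → ℝ}

theorem exists_pow_le_mul_exp (k : ℕ) {μ γ : ℝ} (hμ : 0 < μ) (hγ : 0 < γ) :
    ∃ M : ℝ, 0 ≤ M ∧ ∀ d : ℝ, 0 ≤ d → (1 + d) ^ k ≤ M * Real.exp (μ * d ^ γ) := by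
  -- For `d ≥ 1` the choice `N ≥ k / γ` gives `d ^ k ≤ (d ^ γ) ^ N`, which one term of the
  -- exponential series controls.
  obtain ⟨N, hN⟩ := exists_nat_ge ((k : ℝ) / γ)
  have hf : (0 : ℝ) < N.factorial := by exact_mod_cast N.factorial_pos
  refine ⟨2 ^ k * max 1 (N.factorial / μ ^ N), by positivity, fun d hd => ?_⟩
  have hr : 0 ≤ d ^ γ := Real.rpow_nonneg hd γ
  rcases le_total d 1 with h1 | h1
  · have e1 : (1 : ℝ) ≤ Real.exp (μ * d ^ γ) := Real.one_le_exp (by positivity)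
    calc (1 + d) ^ k ≤ 2 ^ k := by gcongr; linarith
      _ = 2 ^ k * 1 * 1 := by ring
      _ ≤ _ := by gcongr; exact le_max_left _ _
  · have e1 : d ^ k ≤ (d ^ γ) ^ N := by
      rw [← Real.rpow_natCast, ← Real.rpow_natCast, ← Real.rpow_mul hd]
      refine Real.rpow_le_rpow_of_exponent_le h1 ?_
      rw [div_le_iff₀ hγ] at hN
      linarith
    have e2 := Real.pow_div_factorial_le_exp (μ * d ^ γ) (by positivity) N
    have e3 : (d ^ γ) ^ N ≤ N.factorial / μ ^ N * Real.exp (μ * d ^ γ) := by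
      rw [div_le_iff₀ hf, mul_pow] at e2
      rw [div_mul_eq_mul_div, le_div_iff₀ (by positivity)]
      linarith
    calc (1 + d) ^ k ≤ (2 * d) ^ k := by gcongr; linarith
      _ = 2 ^ k * d ^ k := mul_pow _ _ _
      _ ≤ 2 ^ k * (N.factorial / μ ^ N * Real.exp (μ * d ^ γ)) := by gcongr; exact e1.trans e3
      _ ≤ _ := by
        rw [mul_assoc]
        gcongr
        exact le_max_right _ _

theorem IsSummablePseudoMetric.nonneg (hM : IsSummablePseudoMetric md) (x y : Conf D) :
    0 ≤ md x y := by
  have h := hM.triangle x y x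
  rw [hM.self, hM.symm y x] at h
  linarith

theorem IsSummablePseudoMetric.rpow_triangle (hM : IsSummablePseudoMetric md) {γ : ℝ} (h0 : 0 < γ)
    (h1 : γ ≤ 1) (x y z : Conf D) : md x z ^ γ ≤ md x y ^ γ + md y z ^ γ :=
  (Real.rpow_le_rpow (hM.nonneg x z) (hM.triangle x y z) h0.le).trans
    (Real.rpow_add_le_add_rpow (hM.nonneg x y) (hM.nonneg y z) h0.le h1)

/-- The lattice sums are bounded uniformly in `x ∈ ℝᴰ`, not only for `x ∈ ℤᴰ`. -/
theorem IsSummablePseudoMetric.exists_tsum_le (hM : IsSummablePseudoMetric md) {μ γ : ℝ}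
    (hμ : 0 < μ) (h0 : 0 < γ) (h1 : γ ≤ 1) : ∃ B : ℝ≥0, ∀ x : Conf D,
      ∑' z : Fin D → ℤ, ENNReal.ofReal (Real.exp (-μ * md x (fun i => (z i : ℝ)) ^ γ)) ≤ B := by
  obtain ⟨B, hB⟩ := hM.summable (μ / 2) (by positivity) γ h0 h1
  refine ⟨(Real.exp (μ / 2)).toNNReal * B, fun x => ?_⟩
  let f : (Fin D → ℤ) → ℝ := fun z => md x (fun i => (z i : ℝ))
  have hbdd : BddBelow (Set.range f) := ⟨0, by rintro _ ⟨z, rfl⟩; exact hM.nonneg _ _⟩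
  -- A lattice point within `1` of minimising the distance to `x` replaces `x`: `md z₀ z ≤ 2 md x z
  -- + 1`. The factor `2` is why summability is invoked at `μ / 2`, and the `1` produces `exp (μ /
  -- 2)`.
  obtain ⟨z₀, hz₀⟩ := exists_lt_of_ciInf_lt (f := f) (a := iInf f + 1) (by linarith)
  have hmin : ∀ z, f z₀ ≤ f z + 1 := fun z => by
    have := ciInf_le hbdd z
    linarith
  rw [ENNReal.coe_mul]
  refine le_trans ?_ (mul_le_mul_right (hB z₀) _)
  rw [← ENNReal.tsum_mul_left]
  refine ENNReal.tsum_le_tsum fun z => ?_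
  rw [← ENNReal.ofReal, ← ENNReal.ofReal_mul (Real.exp_pos _).le, ← Real.exp_add]
  refine ENNReal.ofReal_le_ofReal (Real.exp_le_exp.2 ?_)
  have hz0 : 0 ≤ f z := hM.nonneg _ _
  have e1 : md (fun i => (z₀ i : ℝ)) (fun i => (z i : ℝ)) ≤ (f z + f z) + 1 := by
    have := hM.triangle (fun i => (z₀ i : ℝ)) x (fun i => (z i : ℝ))
    rw [hM.symm _ x] at this
    have := hmin z
    simp only [f] at *
    linarith
  have e2 := Real.rpow_le_rpow (hM.nonneg _ _) e1 h0.le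
  have e3 := Real.rpow_add_le_add_rpow (add_nonneg hz0 hz0) zero_le_one h0.le h1
  have e4 := Real.rpow_add_le_add_rpow hz0 hz0 h0.le h1
  rw [Real.one_rpow] at e3
  have e5 : md (fun i => (z₀ i : ℝ)) (fun i => (z i : ℝ)) ^ γ ≤ 2 * f z ^ γ + 1 := by linarith
  change -μ * f z ^ γ ≤ _
  nlinarith

end PseudoMetric

/-! ### Decay of the correlations of squared amplitudes. -/

section Decay

open Filter Topology

variable {D : ℕ} {W : Type*} [mW : MeasurableSpace W] {P : Measure W} {𝔒 : Set (Set (Conf D))} {H : ∀ Ω : Set (Conf D), W → (L2on Ω →ₗ.[ℂ] L2on Ω)}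
  {md : Conf D → Conf D → ℝ}

theorem ae_localTrace_ne_top (hH : IsOperatorFamily 𝔒 H) (hW : Wegner P 𝔒 H) {I : Set ℝ}
    (hI : IsBoundedInterval I) {Ω : Set (Conf D)} (hΩ : Ω ∈ 𝔒) (x : Conf D) :
    ∀ᵐ ω ∂P, localTrace (H Ω ω) x I ≠ ∞ := by
  obtain ⟨C, hC⟩ := hW I hI
  have h := hC x Ω hΩ I le_rfl hI.1
  have h2 := ae_lt_top (measurable_localTrace (hH.measurable Ω hΩ) (hH.selfAdjoint Ω hΩ)
    (hH.purePoint Ω hΩ) x hI.1.measurableSet)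
    (ne_top_of_le_ne_top (ENNReal.mul_ne_top ENNReal.coe_ne_top hI.2.measure_lt_top.ne) h)
  filter_upwards [h2] with ω hω using hω.ne

variable [IsProbabilityMeasure P]

/-- Exponential decay of the correlations of squared amplitudes at large distance. -/
theorem exists_decay_of_le_dist (hH : IsOperatorFamily 𝔒 H)
    (hM : IsSummablePseudoMetric md) (hL : Locality P 𝔒 H) (hGW : GeometricWegner P md 𝔒 H)
    {I : Set ℝ} (hI : IsBoundedInterval I)
    {a ν s γ : ℝ} (ha : 0 < a) (hν : 0 < ν) (hs0 : 0 < s) (hs1 : s < 1) (hγ0 : 0 < γ)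
    (hFM : ∀ x y : Conf D, ∀ Ω ∈ 𝔒, ∀ z : ℂ, z.re ∈ I → 0 < |z.im| → |z.im| < 1 →
      ∫⁻ ω, ‖chi Ω x ∘L resolventOp (H Ω ω) z ∘L chi Ω y‖ₑ ^ s ∂P
        ≤ ENNReal.ofReal (a * Real.exp (-ν * md x y ^ γ))) :
    ∃ r₀ μ : ℝ, ∃ C : ℝ≥0∞, 0 < μ ∧ C ≠ ∞ ∧ ∀ x y : Conf D, r₀ ≤ md x y → ∀ Ω ∈ 𝔒,
      ∫⁻ ω, ∑' t, I.indicator (fun t => amp (H Ω ω) x {t} ^ 2 * amp (H Ω ω) y {t} ^ 2) t ∂P ≤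
        C * ENNReal.ofReal (Real.exp (-μ * md x y ^ γ)) := by
  obtain ⟨CL, hL⟩ := hL
  obtain ⟨r₀, K, k, Cg, hGW⟩ := hGW
  -- Since `Γ` is at distance at least `d / 4` from `u`, the moments decay like `exp (-2 μ d ^ γ)`;
  -- one half of the rate absorbs the polynomial number of balls.
  set μ : ℝ := ν * (1 / 4) ^ γ / 2 with hμdef
  have hμ : 0 < μ := by positivity
  obtain ⟨M, hM0, hMle⟩ := exists_pow_le_mul_exp k hμ hγ0
  have hV : volume I ≠ ∞ := hI.2.measure_lt_top.ne
  refine ⟨r₀, μ, Cg I * volume I * ((CL I : ℝ≥0∞) ^ s * ENNReal.ofReal (|K| * M * 4 ^ D * a)), hμ,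
    ?_, fun x y hxy Ω hΩ => ?_⟩
  · refine ENNReal.mul_ne_top (ENNReal.mul_ne_top ENNReal.coe_ne_top hV)
      (ENNReal.mul_ne_top (ENNReal.rpow_ne_top_of_nonneg hs0.le ENNReal.coe_ne_top)
        ENNReal.ofReal_ne_top)
  have hop := hH.isOpen
  have hsa := hH.selfAdjoint
  have hpp := hH.purePoint
  have hme := hH.measurable
  obtain ⟨Ω', hΩ', hbdd, hsub, m, hm, u, w, huw, hu, hdist, ⟨T, hTcard, hT⟩, hmeas, hcond⟩ :=
    hGW x y hxy Ω hΩ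
  obtain ⟨ξ, hξs, hξ, hξ1, -, hpair⟩ := hL Ω hΩ Ω' hΩ' hsub
  obtain ⟨T', hT'mem, hT'card, hT'⟩ := exists_half_ball_cover hT
  obtain ⟨Z, hZ⟩ := exists_half_ball_cover_of_isBounded hbdd
  set d := md x y with hd
  have hd0 : 0 ≤ d := hM.nonneg x y
  set α : ℝ := a * Real.exp (-ν * (d / 4) ^ γ) with hα
  have hα0 : 0 ≤ α := by positivity
  have hbound := fun n => lintegral_tsum_amp_sq_le (P := P) hm (hop Ω hΩ) (hop Ω' hΩ')
    (hsa Ω hΩ) (hpp Ω hΩ) (hme Ω hΩ) (hsa Ω' hΩ') (hpp Ω' hΩ') hmeas hI hξs.continuous.measurable hξ hξ1 hpair hu hT' hZ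
    (c := Cg I) (hcond I hI) hs0 hs1 (a := ENNReal.ofReal α) (b := ENNReal.ofReal a)
    (fun v hv z hz h0 h1 => (hFM u v Ω' hΩ' z hz h0 h1).trans (ENNReal.ofReal_le_ofReal (by
      rw [hα]
      gcongr a * Real.exp ?_
      have : (d / 4) ^ γ ≤ md u v ^ γ :=
        Real.rpow_le_rpow (by positivity) (hdist v (hT'mem v hv)) hγ0.le
      nlinarith)))
    (fun v hv z hz h0 h1 => (hFM u v Ω' hΩ' z hz h0 h1).trans (ENNReal.ofReal_le_ofReal (by
      refine mul_le_of_le_one_right ha.le (Real.exp_le_one_iff.2 ?_)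
      have := Real.rpow_nonneg (hM.nonneg u v) γ
      nlinarith))) n
  -- Only the error term depends on `n`. The cover `Z` is finite and independent of `n`, so its size
  -- disappears in the limit.
  have hlim : Tendsto (fun n : ℕ => (Cg I : ℝ≥0∞) * volume I *
      ((CL I : ℝ≥0∞) ^ s * (T'.card * ENNReal.ofReal α) +
        ENNReal.ofReal (2 * (1 / ((n : ℝ) + 1))) ^ s * (Z.card * ENNReal.ofReal a))) atTop
      (𝓝 (Cg I * volume I * ((CL I : ℝ≥0∞) ^ s * (T'.card * ENNReal.ofReal α) +
        0 * (Z.card * ENNReal.ofReal a)))) := by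
    have h1 : Tendsto (fun n : ℕ => ENNReal.ofReal (2 * (1 / ((n : ℝ) + 1))) ^ s) atTop (𝓝 0) := by
      have h2 := (tendsto_one_div_add_atTop_nhds_zero_nat (𝕜 := ℝ)).const_mul 2
      have h3 := (ENNReal.tendsto_ofReal h2).ennrpow_const s
      rwa [mul_zero, ENNReal.ofReal_zero, ENNReal.zero_rpow_of_pos hs0] at h3
    have hfin : (Z.card : ℝ≥0∞) * ENNReal.ofReal a ≠ ∞ :=
      ENNReal.mul_ne_top (ENNReal.natCast_ne_top _) ENNReal.ofReal_ne_top
    refine ENNReal.Tendsto.const_mul ?_ (Or.inr (ENNReal.mul_ne_top ENNReal.coe_ne_top hV))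
    exact tendsto_const_nhds.add (ENNReal.Tendsto.mul_const h1 (Or.inr hfin))
  have hle := ge_of_tendsto' hlim hbound
  rw [zero_mul, add_zero] at hle
  have hswap : ∫⁻ ω, ∑' t, I.indicator
        (fun t => amp (H Ω ω) x {t} ^ 2 * amp (H Ω ω) y {t} ^ 2) t ∂P =
      ∫⁻ ω, ∑' t, I.indicator
        (fun t => amp (H Ω ω) u {t} ^ 2 * amp (H Ω ω) w {t} ^ 2) t ∂P := by
    rcases huw with ⟨rfl, rfl⟩ | ⟨rfl, rfl⟩
    · rfl
    · simp_rw [mul_comm]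
  rw [hswap]
  refine hle.trans ?_
  rw [mul_assoc _ _ (ENNReal.ofReal _), mul_assoc _ _ (ENNReal.ofReal _)]
  refine mul_le_mul' le_rfl (mul_le_mul' le_rfl ?_)
  rw [← ENNReal.ofReal_natCast, ← ENNReal.ofReal_mul (by positivity),
    ← ENNReal.ofReal_mul (by positivity)]
  refine ENNReal.ofReal_le_ofReal ?_
  have hcard : (T'.card : ℝ) ≤ |K| * (1 + d) ^ k * 4 ^ D := by
    calc (T'.card : ℝ) ≤ T.card * 4 ^ D := by exact_mod_cast hT'card
      _ ≤ |K| * (1 + d) ^ k * 4 ^ D := by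
        gcongr
        refine hTcard.trans ?_
        gcongr
        exact le_abs_self K
  have hexp : Real.exp (-ν * (d / 4) ^ γ) = Real.exp (-μ * d ^ γ) * Real.exp (-μ * d ^ γ) := by
    rw [← Real.exp_add, div_eq_mul_one_div d 4, Real.mul_rpow hd0 (by norm_num), hμdef]
    congr 1
    ring
  have hMd : (1 + d) ^ k * Real.exp (-μ * d ^ γ) ≤ M := by
    have := hMle d hd0
    rw [neg_mul, Real.exp_neg, ← div_eq_mul_inv, div_le_iff₀ (Real.exp_pos _)]
    exact this
  calc (T'.card : ℝ) * α ≤ |K| * (1 + d) ^ k * 4 ^ D * α := by gcongr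
    _ = |K| * ((1 + d) ^ k * Real.exp (-μ * d ^ γ)) * 4 ^ D * a * Real.exp (-μ * d ^ γ) := by
        rw [hα, hexp]; ring
    _ ≤ |K| * M * 4 ^ D * a * Real.exp (-μ * d ^ γ) := by gcongr

/-- Exponential decay of the correlations of squared amplitudes. -/
theorem exists_decay_amp_sq (hH : IsOperatorFamily 𝔒 H)
    (hM : IsSummablePseudoMetric md) (hL : Locality P 𝔒 H) (hGW : GeometricWegner P md 𝔒 H)
    (hW : Wegner P 𝔒 H) {I : Set ℝ} (hI : IsBoundedInterval I)
    {a ν s γ : ℝ} (ha : 0 < a) (hν : 0 < ν) (hs0 : 0 < s) (hs1 : s < 1) (hγ0 : 0 < γ)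
    (hFM : ∀ x y : Conf D, ∀ Ω ∈ 𝔒, ∀ z : ℂ, z.re ∈ I → 0 < |z.im| → |z.im| < 1 →
      ∫⁻ ω, ‖chi Ω x ∘L resolventOp (H Ω ω) z ∘L chi Ω y‖ₑ ^ s ∂P
        ≤ ENNReal.ofReal (a * Real.exp (-ν * md x y ^ γ))) :
    ∃ μ : ℝ, ∃ C : ℝ≥0∞, 0 < μ ∧ C ≠ ∞ ∧ ∀ x y : Conf D, ∀ Ω ∈ 𝔒,
      ∫⁻ ω, ∑' t, I.indicator (fun t => amp (H Ω ω) x {t} ^ 2 * amp (H Ω ω) y {t} ^ 2) t ∂P ≤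
        C * ENNReal.ofReal (Real.exp (-μ * md x y ^ γ)) := by
  obtain ⟨r₀, μ, C, hμ, hC, hdecay⟩ :=
    exists_decay_of_le_dist hH hM hL hGW hI ha hν hs0 hs1 hγ0 hFM
  obtain ⟨Cw, hCw⟩ := hW I hI
  have hV : volume I ≠ ∞ := hI.2.measure_lt_top.ne
  -- At distances below `r₀` the Wegner bound alone suffices, with `exp (μ |r₀| ^ γ)` compensating
  -- the decay factor.
  refine ⟨μ, C + Cw * volume I * ENNReal.ofReal (Real.exp (μ * |r₀| ^ γ)), hμ, ?_,
    fun x y Ω hΩ => ?_⟩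
  · exact ENNReal.add_ne_top.2 ⟨hC, ENNReal.mul_ne_top
      (ENNReal.mul_ne_top ENNReal.coe_ne_top hV) ENNReal.ofReal_ne_top⟩
  rw [add_mul]
  rcases le_or_gt r₀ (md x y) with h | h
  · exact le_add_right (hdecay x y h Ω hΩ)
  · refine le_add_left ?_
    have h1 : ∫⁻ ω, ∑' t, I.indicator
        (fun t => amp (H Ω ω) x {t} ^ 2 * amp (H Ω ω) y {t} ^ 2) t ∂P ≤
        ∫⁻ ω, localTrace (H Ω ω) x I ∂P := by
      refine lintegral_mono fun ω => ?_
      rw [localTrace_eq_tsum (hH.selfAdjoint Ω hΩ ω) x I]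
      refine ENNReal.tsum_le_tsum fun t => Set.indicator_le_indicator ?_
      exact (mul_le_of_le_one_right zero_le (pow_le_one₀ zero_le (amp_le_one _ _))).trans
        (amp_sq_le_localTrace x _)
    refine h1.trans ((hCw x Ω hΩ I le_rfl hI.1).trans ?_)
    rw [mul_assoc _ (ENNReal.ofReal _) (ENNReal.ofReal _), ← ENNReal.ofReal_mul (Real.exp_pos _).le,
      ← Real.exp_add]
    refine le_mul_of_one_le_right zero_le (ENNReal.one_le_ofReal.2 (Real.one_le_exp ?_))
    have : md x y ^ γ ≤ |r₀| ^ γ :=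
      Real.rpow_le_rpow (hM.nonneg x y) (h.le.trans (le_abs_self r₀)) hγ0.le
    nlinarith

end Decay

/-! ### From squared amplitudes to first powers. -/

section Assembly

open Filter Topology

/-- Either `q ≤ b p` or `b p ≤ q`, and in each case one summand suffices. The form with `c * b = 1`
avoids division in `ℝ≥0∞`. -/
theorem mul_le_weighted_sq {p q b c : ℝ≥0∞} (hbc : c * b = 1) : p * q ≤ b * p ^ 2 + c * q ^ 2 := by
  rcases le_total q (b * p) with h | h
  · refine le_add_right ?_
    calc p * q ≤ p * (b * p) := by gcongr
      _ = b * p ^ 2 := by ring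
  · refine le_add_left ?_
    calc p * q = (c * b) * p * q := by rw [hbc, one_mul]
      _ = c * (b * p) * q := by ring
      _ ≤ c * q * q := by gcongr
      _ = c * q ^ 2 := by ring

variable {D : ℕ} {Ω : Set (Conf D)} {A : L2on Ω →ₗ.[ℂ] L2on Ω}

/-- Insertion of a partition of unity over the lattice into a product of amplitudes. -/
theorem amp_mul_amp_le_tsum (x y : Conf D) (t : ℝ) : amp A x {t} * amp A y {t} ≤
    ∑' z : Fin D → ℤ, amp A x {t} * amp A y {t} *
      (amp A (fun i => (z i : ℝ)) {t} * amp A (fun i => (z i : ℝ)) {t}) ^ 1 := by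
  by_cases h : spectralProj A {t} = 0
  · have : amp A x {t} = 0 := by
      rw [amp, h, ContinuousLinearMap.comp_zero]
      exact enorm_eq_zero.2 rfl
    rw [this, zero_mul]
    exact zero_le
  · rw [ENNReal.tsum_mul_left]
    refine le_mul_of_one_le_right zero_le ?_
    simpa only [pow_one, ← sq] using one_le_tsum_amp_sq h

end Assembly

end RandOp

/-! ### The main theorem: insertion of lattice points and summation. -/

theorem theorem2p4 {D : ℕ} {W : Type*} [MeasurableSpace W] (P : Measure W) [IsProbabilityMeasure P]
    (𝔒 : Set (Set (Conf D))) (H : ∀ Ω : Set (Conf D), W → (L2on Ω →ₗ.[ℂ] L2on Ω))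
    (hH : IsOperatorFamily 𝔒 H)
    (md : Conf D → Conf D → ℝ) (hM : IsSummablePseudoMetric md)
    (hL : Locality P 𝔒 H) (hGW : GeometricWegner P md 𝔒 H) (hW : Wegner P 𝔒 H)
    (I : Set ℝ) (hI : IsBoundedInterval I)
    (A ν s γ : ℝ) (hA : 0 < A) (hν : 0 < ν) (hs0 : 0 < s) (hs1 : s < 1) (hγ0 : 0 < γ) (hγ1 : γ ≤ 1)
    (hFM : ∀ x y : Conf D, ∀ Ω ∈ 𝔒, ∀ z : ℂ, z.re ∈ I → 0 < |z.im| → |z.im| < 1 →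
      ∫⁻ ω, ‖chi Ω x ∘L resolventOp (H Ω ω) z ∘L chi Ω y‖ₑ ^ s ∂P
        ≤ ENNReal.ofReal (A * Real.exp (-ν * md x y ^ γ))) :
    ∃ C μ : ℝ, 0 < C ∧ 0 < μ ∧ ∀ x y : Conf D, ∀ Ω ∈ 𝔒,
      AEMeasurable (fun ω => correlator (H Ω ω) I x y) P ∧
      ∫⁻ ω, correlator (H Ω ω) I x y ∂P ≤ ENNReal.ofReal (C * Real.exp (-μ * md x y ^ γ)) := by
  obtain ⟨μ, C, hμ, hC, hdecay⟩ := exists_decay_amp_sq hH hM hL hGW hW hI hA hν hs0 hs1 hγ0 hFM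
  obtain ⟨B, hB⟩ := hM.exists_tsum_le (μ := μ / 4) (by positivity) hγ0 hγ1
  have hCB : 2 * C * B ≠ ∞ :=
    ENNReal.mul_ne_top (ENNReal.mul_ne_top ENNReal.ofNat_ne_top hC) ENNReal.coe_ne_top
  -- The `+ 1` secures a strictly positive constant.
  refine ⟨(2 * C * B).toReal + 1, μ / 4, by positivity, by positivity, fun x y Ω hΩ => ?_⟩
  have hsa := hH.selfAdjoint Ω hΩ
  have hmeas := aemeasurable_tsum_amp (P := P) (hH.measurable Ω hΩ) hsa (hH.purePoint Ω hΩ) hI.1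
    (ae_localTrace_ne_top hH hW hI hΩ)
  simp_rw [fun ω => correlator_eq (hsa ω) I x y]
  constructor
  · simpa only [pow_zero, mul_one] using hmeas x y x y 0
  let L : (Fin D → ℤ) → Conf D := fun z i => (z i : ℝ)
  let δ : Conf D → Conf D → ℝ := fun x y => md x y ^ γ
  have hδ0 : ∀ x y, 0 ≤ δ x y := fun x y => Real.rpow_nonneg (hM.nonneg x y) γ
  have hdecay' : ∀ x y, ∫⁻ ω, ∑' t, I.indicator (fun t => amp (H Ω ω) x {t} * amp (H Ω ω) y {t} *
      (amp (H Ω ω) x {t} * amp (H Ω ω) y {t}) ^ 1) t ∂P ≤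
        C * ENNReal.ofReal (Real.exp (-μ * δ x y)) := fun x y => by
    convert hdecay x y Ω hΩ using 7
    ring
  have hz : ∀ z, ∫⁻ ω, ∑' t, I.indicator (fun t => amp (H Ω ω) x {t} * amp (H Ω ω) y {t} *
      (amp (H Ω ω) (L z) {t} * amp (H Ω ω) (L z) {t}) ^ 1) t ∂P ≤
      2 * C * ENNReal.ofReal (Real.exp (-(μ / 4) * δ x y)) *
        ENNReal.ofReal (Real.exp (-(μ / 4) * δ x (L z))) := by
    intro z
    -- This weight balances the two terms: both then decay like `exp (-(μ/2) (δ x z + δ z y))`.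
    set lam : ℝ := Real.exp (μ / 2 * (δ x (L z) - δ (L z) y)) with hlam
    have hinv : ENNReal.ofReal lam⁻¹ * ENNReal.ofReal lam = 1 := by
      rw [← ENNReal.ofReal_mul (by positivity), inv_mul_cancel₀ (Real.exp_pos _).ne',
        ENNReal.ofReal_one]
    have hpt : ∀ ω, ∑' t, I.indicator (fun t => amp (H Ω ω) x {t} * amp (H Ω ω) y {t} *
        (amp (H Ω ω) (L z) {t} * amp (H Ω ω) (L z) {t}) ^ 1) t ≤
        ENNReal.ofReal lam * ∑' t, I.indicator (fun t => amp (H Ω ω) x {t} *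
          amp (H Ω ω) (L z) {t} * (amp (H Ω ω) x {t} * amp (H Ω ω) (L z) {t}) ^ 1) t +
        ENNReal.ofReal lam⁻¹ * ∑' t, I.indicator (fun t => amp (H Ω ω) (L z) {t} *
          amp (H Ω ω) y {t} * (amp (H Ω ω) (L z) {t} * amp (H Ω ω) y {t}) ^ 1) t := by
      intro ω
      rw [← ENNReal.tsum_mul_left, ← ENNReal.tsum_mul_left, ← ENNReal.tsum_add]
      refine ENNReal.tsum_le_tsum fun t => ?_
      by_cases ht : t ∈ I
      · simp only [Set.indicator_of_mem ht, pow_one, ← sq]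
        refine le_of_eq_of_le ?_ (mul_le_weighted_sq (p := amp (H Ω ω) x {t} *
          amp (H Ω ω) (L z) {t}) (q := amp (H Ω ω) (L z) {t} * amp (H Ω ω) y {t}) hinv)
        ring
      · simp only [Set.indicator_of_notMem ht, mul_zero, add_zero, le_refl]
    have h1 := hδ0 x y
    have h2 : δ x y ≤ δ x (L z) + δ (L z) y := hM.rpow_triangle hγ0 hγ1 x (L z) y
    have h3 := hδ0 (L z) y
    calc _ ≤ ∫⁻ ω, ENNReal.ofReal lam * ∑' t, I.indicator (fun t => amp (H Ω ω) x {t} *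
          amp (H Ω ω) (L z) {t} * (amp (H Ω ω) x {t} * amp (H Ω ω) (L z) {t}) ^ 1) t +
        ENNReal.ofReal lam⁻¹ * ∑' t, I.indicator (fun t => amp (H Ω ω) (L z) {t} *
          amp (H Ω ω) y {t} * (amp (H Ω ω) (L z) {t} * amp (H Ω ω) y {t}) ^ 1) t ∂P :=
          lintegral_mono hpt
      _ ≤ ENNReal.ofReal lam * (C * ENNReal.ofReal (Real.exp (-μ * δ x (L z)))) +
          ENNReal.ofReal lam⁻¹ * (C * ENNReal.ofReal (Real.exp (-μ * δ (L z) y))) := by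
          rw [lintegral_add_left' ((hmeas x (L z) x (L z) 1).const_mul _),
            lintegral_const_mul'' _ (hmeas x (L z) x (L z) 1),
            lintegral_const_mul'' _ (hmeas (L z) y (L z) y 1)]
          gcongr
          · exact hdecay' x (L z)
          · exact hdecay' (L z) y
      _ = 2 * C * ENNReal.ofReal (Real.exp (-(μ / 2) * (δ x (L z) + δ (L z) y))) := by
          rw [mul_left_comm, mul_left_comm _ C, ← ENNReal.ofReal_mul (by positivity),
            ← ENNReal.ofReal_mul (by positivity), hlam, ← Real.exp_neg, ← Real.exp_add,
            ← Real.exp_add, two_mul, add_mul]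
          congr 4 <;> ring
      -- Half of the exponent gives `δ x y` by the triangle inequality for `δ`; the other half keeps
      -- `δ x z` for the lattice sum and drops `δ z y`.
      _ ≤ _ := by
          rw [mul_assoc _ (ENNReal.ofReal _) (ENNReal.ofReal _),
            ← ENNReal.ofReal_mul (by positivity), ← Real.exp_add]
          gcongr
          nlinarith
  calc _ ≤ ∫⁻ ω, ∑' z : Fin D → ℤ, ∑' t, I.indicator (fun t => amp (H Ω ω) x {t} *
        amp (H Ω ω) y {t} * (amp (H Ω ω) (L z) {t} * amp (H Ω ω) (L z) {t}) ^ 1) t ∂P := by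
        refine lintegral_mono fun ω => ?_
        rw [ENNReal.tsum_comm]
        refine ENNReal.tsum_le_tsum fun t => ?_
        by_cases ht : t ∈ I
        · simp only [Set.indicator_of_mem ht]
          exact amp_mul_amp_le_tsum x y t
        · simp only [Set.indicator_of_notMem ht]
          exact zero_le
    _ = ∑' z : Fin D → ℤ, ∫⁻ ω, ∑' t, I.indicator (fun t => amp (H Ω ω) x {t} *
        amp (H Ω ω) y {t} * (amp (H Ω ω) (L z) {t} * amp (H Ω ω) (L z) {t}) ^ 1) t ∂P :=
        lintegral_tsum fun z => hmeas x y (L z) (L z) 1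
    _ ≤ ∑' z : Fin D → ℤ, 2 * C * ENNReal.ofReal (Real.exp (-(μ / 4) * δ x y)) *
        ENNReal.ofReal (Real.exp (-(μ / 4) * δ x (L z))) := ENNReal.tsum_le_tsum hz
    _ ≤ 2 * C * ENNReal.ofReal (Real.exp (-(μ / 4) * δ x y)) * B := by
        rw [ENNReal.tsum_mul_left]
        gcongr
        exact hB x
    _ = 2 * C * B * ENNReal.ofReal (Real.exp (-(μ / 4) * δ x y)) := by ring
    _ ≤ ENNReal.ofReal ((2 * C * B).toReal + 1) *
        ENNReal.ofReal (Real.exp (-(μ / 4) * δ x y)) := by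
        gcongr
        refine (ENNReal.le_ofReal_iff_toReal_le hCB (by positivity)).2 ?_
        linarith
    _ = _ := by rw [← ENNReal.ofReal_mul (by positivity)]
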